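/- Let $\mathcal H_{\mathbb R}$ be a real Hilbert space with complexification $\mathcal H$ (involution $f\mapsto\bar f$, inner product linear in the first argument), $\mathcal F=\bigoplus_{n\ge0}\mathcal H^{\otimes n}$ the algebraic full Fock space with vacuum $\Omega$, $l(f)$, $l^*(f)$ the creation and annihilation operators, $\omega(f)=l(f)+l^*(\bar f)$, and $\mathcal A$ the complex unital algebra generated by all $\omega(f)$, $f\in\mathcal H_{\mathbb R}$. Define $W(\Omega)=1$, $W(f)=\omega(f)$, $W(f\otimes f_1\otimes\cdots\otimes f_n)=\omega(f)W(f_1\otimes\cdots\otimes f_n)-\langle f_1,\bar f\rangle W(f_2\otimes\cdots\otimes f_n)$, and the cyclic Wick products $C(f)=\omega(f)$, $C(f_1\otimes\cdots\otimes f_n)=W(f_1\otimes\cdots\otimes f_n)-\langle f_1,\bar f_n\rangle W(f_2\otimes\cdots\otimes f_{n-1})$ for $n\ge2$. The algebraic cyclic Fock space is the direct sum of the spaces of circular tensors $[f_1\otimes\cdots\otimes f_n]$ (tensors modulo cyclic rotation) with $$\langle [f_1\otimes\cdots\otimes f_n],[g_1\otimes\cdots\otimes g_m]\rangle_{\rm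 cyc}=\delta_{nm}\sum_{k=0}^{n-1}\langle f_1,g_{1+k}\rangle\cdots\langle f_n,g_{n+k}\rangle\qquad(n,m\ge 1,\ \text{indices mod } n),$$ and $\mathbf c$ is the linear map from $\mathcal F$ to it with $\mathbf c\,\Omega=0$, $\mathbf c f=[f]$, $\mathbf c(f_1\otimes\cdots\otimes f_n)=[f_1\otimes\cdots\otimes f_n]+\langle f_1,\bar f_n\rangle\,\mathbf c(f_2\otimes\cdots\otimes f_{n-1})$ for $n\geq 2$. Let $T_n,U_n$ be the Chebyshev polynomials of the first and second kind and $V_n(x)=U_n(x/2)$. Call $f_1,\dots,f_k\in\mathcal H_{\mathbb R}$ cyclically orthogonal if $f_i\perp f_{i+1}$ for $i=1,\dots,k$, where $f_{k+1}=f_1$. Then: 1. For $f_1,\dots,f_n\in\mathcal H$ $(n\ge 0)$, $W(f_1\otimes\cdots\otimes f_n)$ is the unique element $w$ of $\mathcal A$ with $w\Omega=f_1\otimes\cdots\otimes f_n$. For $n\ge1$, $C(f_1\otimes\cdots\otimes f_n)\in\mathcal A$ and $\mathbf c\,C(f_1\otimes\cdots\otimes f_n)\Omega=[f_1\otimes\cdots\otimes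 f_n]$. 2. If $f\in\mathcal H_{\mathbb R}$ and $\|f\|=1$, then $W(f^{\otimes n})=U_n(\omega(f)/2)$ for $n\ge0$ and $C(f^{\otimes n})=2T_n(\omega(f)/2)$ for $n\ge1$. 3. Let $f_1,\dots,f_k\in\mathcal H_{\mathbb R}$ and $n(1),\dots,n(k)>0$. If $f_i\perp f_{i+1}$ for $1\le i<k$, then $W(f_1^{\otimes n(1)}\otimes\cdots\otimes f_k^{\otimes n(k)})=W(f_1^{\otimes n(1)})\cdots W(f_k^{\otimes n(k)})$. If $k\ge1$ and $f_1,\dots,f_k$ are cyclically orthogonal, then also $C(f_1^{\otimes n(1)}\otimes\cdots\otimes f_k^{\otimes n(k)})=W(f_1^{\otimes n(1)}\otimes\cdots\otimes f_k^{\otimes n(k)})=W(f_1^{\otimes n(1)})\cdots W(f_k^{\otimes n(k)})$. 4. For each $N$ let $X_N(f)=(x_{ij}(f))_{i,j=1}^N$, $f\in\mathcal H_{\mathbb R}$, be Hermitian random matrices whose entries form a centered Gaussian family with $\mathrm E\{x_{ij}(f)x_{kl}(g)\}=0$ for $i<j$, $k<l$ and $\mathrm E\{x_{ij}(f)\overline{x_{kl}(g)}\}=\delta_{ik}\delta_{jl}\frac1N\langle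 f,g\rangle$ for $i\le j$, $k\le l$; write $\mathrm k_2\{A,B\}=\mathrm E\{AB\}-\mathrm E\{A\}\mathrm E\{B\}$. Let $k,l\ge2$, let $f_1,\dots,f_k$ and $g_1,\dots,g_l$ be cyclically orthogonal unit vectors in $\mathcal H_{\mathbb R}$, let $f,g\in\mathcal H_{\mathbb R}$ be unit vectors, and let all $n(i),m(j),n,m$ be positive integers. All traces below are square integrable for every $N$, and $$\lim_{N\to\infty}\mathrm k_2\bigl\{\mathrm{Tr}[V_{n(1)}(X_N(f_1))\cdots V_{n(k)}(X_N(f_k))],\mathrm{Tr}[V_{m(1)}(X_N(g_1))\cdots V_{m(l)}(X_N(g_l))]\bigr\}=\langle[f_1^{\otimes n(1)}\otimes\cdots\otimes f_k^{\otimes n(k)}],[g_l^{\otimes m(l)}\otimes\cdots\otimes g_1^{\otimes m(1)}]\rangle_{\rm cyc},$$ $$\lim_{N\to\infty}\mathrm k_2\bigl\{\mathrm{Tr}[V_{n(1)}(X_N(f_1))\cdots V_{n(k)}(X_N(f_k))],\mathrm{Tr}[2T_m(\tfrac12X_N(g))]\bigr\}=\langle[f_1^{\otimes n(1)}\otimes\cdots\otimes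 f_k^{\otimes n(k)}],[g^{\otimes m}]\rangle_{\rm cyc},$$ $$\lim_{N\to\infty}\mathrm k_2\bigl\{\mathrm{Tr}[2T_n(\tfrac12X_N(f))],\mathrm{Tr}[2T_m(\tfrac12X_N(g))]\bigr\}=\langle[f^{\otimes n}],[g^{\otimes m}]\rangle_{\rm cyc}.$$ 5. These inner products diagonalize the limit covariance: for an orthonormal family $(e_i)_{i\in I}$ in $\mathcal H_{\mathbb R}$ and words $u=(u_1,\dots,u_p)$, $v=(v_1,\dots,v_q)$ in $I$ with $q\ge1$, $\langle[e_{u_1}\otimes\cdots\otimes e_{u_p}],[e_{v_1}\otimes\cdots\otimes e_{v_q}]\rangle_{\rm cyc}$ is the number of $k\in\{0,\dots,q-1\}$ such that rotating $v$ cyclically by $k$ places gives $u$; in particular it is $0$ unless $u$ is a cyclic rotation of $v$. -/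

import Mathlib

open MeasureTheory ProbabilityTheory Filter Topology
open scoped ComplexConjugate

set_option linter.unusedSectionVars false

namespace CyclicFock

noncomputable section

/-! ### The complexification of a real inner product space -/

/-- The complexification `V ⊕ iV` of a real vector space `V`; `⟨x, y⟩` stands for `x + i y`. -/
@[ext] structure Cplx (V : Type*) where
  re : V
  im : V

namespace Cplx

variable {V : Type*} [NormedAddCommGroup V] [InnerProductSpace ℝ V]

instance : AddCommGroup (Cplx V) :=
  Equiv.addCommGroup (β := V × V)
    ⟨fun z => (z.re, z.im), fun p => ⟨p.1, p.2⟩, fun _ => rfl, fun _ => rfl⟩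

@[simp] lemma add_re (z w : Cplx V) : (z + w).re = z.re + w.re := rfl
@[simp] lemma add_im (z w : Cplx V) : (z + w).im = z.im + w.im := rfl

instance : SMul ℂ (Cplx V) :=
  ⟨fun c z => ⟨c.re • z.re - c.im • z.im, c.re • z.im + c.im • z.re⟩⟩

@[simp] lemma smul_re (c : ℂ) (z : Cplx V) : (c • z).re = c.re • z.re - c.im • z.im := rfl
@[simp] lemma smul_im (c : ℂ) (z : Cplx V) : (c • z).im = c.re • z.im + c.im • z.re := rfl
@[simp] lemma zero_re : (0 : Cplx V).re = 0 := rfl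
@[simp] lemma zero_im : (0 : Cplx V).im = 0 := rfl

instance : Module ℂ (Cplx V) where
  one_smul z := by ext <;> simp
  mul_smul a b z := by
    ext <;> simp only [smul_re, smul_im, Complex.mul_re, Complex.mul_im] <;> module
  smul_zero a := by ext <;> simp
  smul_add a z w := by
    ext <;> simp only [smul_re, smul_im, add_re, add_im] <;> module
  add_smul a b z := by
    ext <;> simp only [smul_re, smul_im, add_re, add_im, Complex.add_re, Complex.add_im] <;>
      module
  zero_smul z := by ext <;> simp

/-- The embedding of `V` into its complexification. -/
def ofReal (x : V) : Cplx V := ⟨x, 0⟩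

/-- The involution `x + i y ↦ x - i y`. -/
def bar (z : Cplx V) : Cplx V := ⟨z.re, -z.im⟩

/-- The inner product of the complexification, linear in the first and antilinear in the second
argument. -/
def form : Cplx V →ₗ[ℂ] Cplx V →ₗ⋆[ℂ] ℂ :=
  LinearMap.mk₂'ₛₗ (RingHom.id ℂ) (starRingEnd ℂ)
    (fun z w => ⟨inner ℝ z.re w.re + inner ℝ z.im w.im, inner ℝ z.im w.re - inner ℝ z.re w.im⟩)
    (by intros; apply Complex.ext <;> simp [inner_add_left] <;> ring)
    (by
      intros
      apply Complex.ext <;>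
        simp [inner_add_left, inner_sub_left, real_inner_smul_left] <;> ring)
    (by intros; apply Complex.ext <;> simp [inner_add_right] <;> ring)
    (by
      intros
      apply Complex.ext <;>
        simp [inner_add_right, inner_sub_right, real_inner_smul_right] <;> ring)

lemma form_apply (z w : Cplx V) : form z w =
    ⟨inner ℝ z.re w.re + inner ℝ z.im w.im, inner ℝ z.im w.re - inner ℝ z.re w.im⟩ := rfl

/-- The bilinear form `(f, g) ↦ ⟨f, ḡ⟩`. -/
def bil : Cplx V →ₗ[ℂ] Cplx V →ₗ[ℂ] ℂ :=
  LinearMap.mk₂ ℂ (fun z w => form z (bar w))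
    (by intros; simp) (by intros; simp)
    (by intros; apply Complex.ext <;> simp [form_apply, bar, inner_add_right] <;> ring)
    (by
      intros
      apply Complex.ext <;>
        simp [form_apply, bar, inner_add_right, inner_sub_right, real_inner_smul_right] <;> ring)

lemma bil_apply (z w : Cplx V) : bil z w = form z (bar w) := rfl

end Cplx

/-! ### The algebraic full (linear) Fock space -/

section Fock

variable {H : Type*} [AddCommGroup H] [Module ℂ H]

/-- The elementary tensor `f₁ ⊗ ⋯ ⊗ fₙ`; the empty one is the vacuum `Ω = 1`. -/
def word (l : List H) : TensorAlgebra ℂ H := (l.map (TensorAlgebra.ι ℂ)).prod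

/-- The coefficient of the vacuum. -/
def vac : TensorAlgebra ℂ H →ₗ[ℂ] ℂ := (TensorAlgebra.algebraMapInv (R := ℂ) (M := H)).toLinearMap

@[simp] lemma word_nil : word ([] : List H) = 1 := rfl
@[simp] lemma word_cons (f : H) (l : List H) :
    word (f :: l) = TensorAlgebra.ι ℂ f * word l := by simp [word]
lemma word_append (l l' : List H) : word (l ++ l') = word l * word l' := by simp [word]
@[simp] lemma vac_one : vac (1 : TensorAlgebra ℂ H) = 1 := by simp [vac]
@[simp] lemma vac_ι_mul (f : H) (x : TensorAlgebra ℂ H) : vac (TensorAlgebra.ι ℂ f * x) = 0 := by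
  simp [vac, TensorAlgebra.algebraMapInv]

lemma span_word : Submodule.span ℂ (Set.range (word : List H → TensorAlgebra ℂ H)) = ⊤ := by
  rw [eq_top_iff]
  rintro x -
  induction x using TensorAlgebra.induction with
  | algebraMap r =>
    rw [Algebra.algebraMap_eq_smul_one]
    exact Submodule.smul_mem _ _ (Submodule.subset_span ⟨[], rfl⟩)
  | ι f => exact Submodule.subset_span ⟨[f], by simp⟩
  | mul a b ha hb =>
    have h := Submodule.mul_mem_mul ha hb
    rw [Submodule.span_mul_span] at h
    refine Submodule.span_mono ?_ h
    rintro _ ⟨_, ⟨l, rfl⟩, _, ⟨l', rfl⟩, rfl⟩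
    exact ⟨l ++ l', word_append l l'⟩
  | add a b ha hb => exact Submodule.add_mem _ ha hb

lemma ext_word {M : Type*} [AddCommMonoid M] [Module ℂ M] {σ : ℂ →+* ℂ}
    {F G : TensorAlgebra ℂ H →ₛₗ[σ] M} (h : ∀ l, F (word l) = G (word l)) : F = G :=
  LinearMap.ext_on_range span_word h

/-- Linear maps out of the Fock space by recursion on the first tensor factor:
`F Ω = m` and `F (f ⊗ x) = s f (x, F x)`. -/
def fockRec {M : Type*} [AddCommGroup M] [Module ℂ M] (m : M)
    (s : H →ₗ[ℂ] (TensorAlgebra ℂ H × M) →ₗ[ℂ] M) : TensorAlgebra ℂ H →ₗ[ℂ] M :=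
  LinearMap.snd ℂ _ _ ∘ₗ
    LinearMap.applyₗ ((1, m) : TensorAlgebra ℂ H × M) ∘ₗ
      (TensorAlgebra.lift ℂ
        (LinearMap.mk₂ ℂ (fun f p => (TensorAlgebra.ι ℂ f * p.1, s f p))
          (by intros; simp [add_mul]) (by intros; simp)
          (by intros; simp [mul_add]) (by intros; simp) :
            H →ₗ[ℂ] Module.End ℂ (TensorAlgebra ℂ H × M))).toLinearMap

section
variable {M : Type*} [AddCommGroup M] [Module ℂ M] (m : M)
    (s : H →ₗ[ℂ] (TensorAlgebra ℂ H × M) →ₗ[ℂ] M)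

@[simp] lemma fockRec_one : fockRec m s 1 = m := by simp [fockRec]

lemma fockRec_ι_mul (f : H) (x : TensorAlgebra ℂ H) :
    fockRec m s (TensorAlgebra.ι ℂ f * x) = s f (x, fockRec m s x) := by
  have key : ∀ x : TensorAlgebra ℂ H,
      (TensorAlgebra.lift ℂ
        (LinearMap.mk₂ ℂ (fun f p => (TensorAlgebra.ι ℂ f * p.1, s f p))
          (by intros; simp [add_mul]) (by intros; simp)
          (by intros; simp [mul_add]) (by intros; simp) :
            H →ₗ[ℂ] Module.End ℂ (TensorAlgebra ℂ H × M)) x) (1, m) = (x, fockRec m s x) := by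
    intro x
    refine Prod.ext ?_ rfl
    have : (LinearMap.fst ℂ _ _ ∘ₗ
      LinearMap.applyₗ ((1, m) : TensorAlgebra ℂ H × M) ∘ₗ
      (TensorAlgebra.lift ℂ
        (LinearMap.mk₂ ℂ (fun f p => (TensorAlgebra.ι ℂ f * p.1, s f p))
          (by intros; simp [add_mul]) (by intros; simp)
          (by intros; simp [mul_add]) (by intros; simp) :
            H →ₗ[ℂ] Module.End ℂ (TensorAlgebra ℂ H × M))).toLinearMap) = LinearMap.id := by
      apply ext_word
      intro l
      induction l with
      | nil => simp
      | cons f l ih =>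
        simp only [LinearMap.comp_apply, LinearMap.applyₗ_apply_apply, LinearMap.fst_apply,
          AlgHom.toLinearMap_apply, LinearMap.id_apply] at ih ⊢
        rw [word_cons, map_mul, Module.End.mul_apply, TensorAlgebra.lift_ι_apply,
          LinearMap.mk₂_apply, ih]
    exact LinearMap.congr_fun this x
  rw [← show _ = s f (x, fockRec m s x) from by rw [← key x]]
  simp only [fockRec, LinearMap.comp_apply, LinearMap.applyₗ_apply_apply, LinearMap.snd_apply,
    AlgHom.toLinearMap_apply]
  rw [map_mul, Module.End.mul_apply, TensorAlgebra.lift_ι_apply, LinearMap.mk₂_apply]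
end

/-- `f₁ ⊗ ⋯ ⊗ fₙ ↦ φ(f₁) f₂ ⊗ ⋯ ⊗ fₙ`, and `Ω ↦ 0`. -/
def contractL (φ : H →ₗ[ℂ] ℂ) : TensorAlgebra ℂ H →ₗ[ℂ] TensorAlgebra ℂ H :=
  fockRec 0 (LinearMap.mk₂ ℂ (fun f p => φ f • p.1)
    (by intros; simp [add_smul]) (by intros; simp [mul_smul])
    (by intros; simp) (by intros; exact smul_comm _ _ _))

@[simp] lemma contractL_one (φ : H →ₗ[ℂ] ℂ) : contractL φ 1 = 0 := by simp [contractL]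
@[simp] lemma contractL_ι_mul (φ : H →ₗ[ℂ] ℂ) (f : H) (x : TensorAlgebra ℂ H) :
    contractL φ (TensorAlgebra.ι ℂ f * x) = φ f • x := by simp [contractL, fockRec_ι_mul]

/-- `f₁ ⊗ ⋯ ⊗ fₙ ↦ φ(fₙ) f₁ ⊗ ⋯ ⊗ fₙ₋₁`, and `Ω ↦ 0`. -/
def contractR (φ : H →ₗ[ℂ] ℂ) : TensorAlgebra ℂ H →ₗ[ℂ] TensorAlgebra ℂ H :=
  fockRec 0 (LinearMap.mk₂ ℂ
    (fun f p => TensorAlgebra.ι ℂ f * p.2 + (vac p.1 * φ f) • (1 : TensorAlgebra ℂ H))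
    (by intros; simp only [map_add, add_mul, mul_add, add_smul]; abel)
    (by intros; simp only [map_smul, smul_mul_assoc, smul_add, smul_smul, smul_eq_mul, mul_left_comm])
    (by intros; simp only [map_add, add_mul, mul_add, add_smul, Prod.fst_add, Prod.snd_add]; abel)
    (by intros; simp [mul_smul]))

@[simp] lemma contractR_one (φ : H →ₗ[ℂ] ℂ) : contractR φ 1 = 0 := by simp [contractR]

lemma contractR_ι_mul (φ : H →ₗ[ℂ] ℂ) (f : H) (x : TensorAlgebra ℂ H) :
    contractR φ (TensorAlgebra.ι ℂ f * x) =
      TensorAlgebra.ι ℂ f * contractR φ x + (vac x * φ f) • (1 : TensorAlgebra ℂ H) := by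
  simp [contractR, fockRec_ι_mul]

lemma contractR_concat (φ : H →ₗ[ℂ] ℂ) (l : List H) (f : H) :
    contractR φ (word (l ++ [f])) = φ f • word l := by
  induction l with
  | nil =>
    have := contractR_ι_mul φ f 1
    simpa using this
  | cons g l ih =>
    have h0 : vac (word (l ++ [f])) = 0 := by
      cases l with
      | nil => simpa using vac_ι_mul f 1
      | cons g l => simp
    rw [List.cons_append, word_cons, contractR_ι_mul, ih, h0]
    simp

lemma contractR_add (φ ψ : H →ₗ[ℂ] ℂ) : contractR (φ + ψ) = contractR φ + contractR ψ := by
  apply ext_word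
  intro l
  induction l using List.reverseRecOn with
  | nil => simp
  | append_singleton l f _ => simp only [LinearMap.add_apply, contractR_concat, add_smul]

lemma contractR_smul (c : ℂ) (φ : H →ₗ[ℂ] ℂ) : contractR (c • φ) = c • contractR φ := by
  apply ext_word
  intro l
  induction l using List.reverseRecOn with
  | nil => simp
  | append_singleton l f _ =>
    simp only [LinearMap.smul_apply, contractR_concat, smul_eq_mul, mul_smul]

/-! ### The cyclic Fock space -/

/-- The span of all `xy - yx`; equivalently, of all
`f₁ ⊗ ⋯ ⊗ fₙ - f_{k+1} ⊗ ⋯ ⊗ fₙ ⊗ f₁ ⊗ ⋯ ⊗ f_k`. -/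
def commutators (H : Type*) [AddCommGroup H] [Module ℂ H] : Submodule ℂ (TensorAlgebra ℂ H) :=
  Submodule.span ℂ {z | ∃ x y, z = x * y - y * x}

/-- The algebraic cyclic Fock space: the direct sum of the spaces of circular tensors, i.e. of
tensors up to cyclic rotation. -/
abbrev CycFock (H : Type*) [AddCommGroup H] [Module ℂ H] := TensorAlgebra ℂ H ⧸ commutators H

/-- The quotient map `f₁ ⊗ ⋯ ⊗ fₙ ↦ [f₁ ⊗ ⋯ ⊗ fₙ]`. -/
def circ : TensorAlgebra ℂ H →ₗ[ℂ] CycFock H := (commutators H).mkQ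

/-- The circular tensor `[f₁ ⊗ ⋯ ⊗ fₙ]`. -/
def circWord (l : List H) : CycFock H := circ (word l)

/-- `x ↦ [x]` with the vacuum component of `x` removed. -/
def circ₀ : TensorAlgebra ℂ H →ₗ[ℂ] CycFock H :=
  circ ∘ₗ (LinearMap.id - (Algebra.linearMap ℂ (TensorAlgebra ℂ H)) ∘ₗ vac)

lemma circ₀_one : circ₀ (1 : TensorAlgebra ℂ H) = 0 := by simp [circ₀]
lemma circ₀_word {l : List H} (hl : l ≠ []) : circ₀ (word l) = circWord l := by
  cases l with
  | nil => exact absurd rfl hl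
  | cons f l => simp [circ₀, circWord]

/-- `f₁ ⊗ ⋯ ⊗ fₙ ↦ ∑ₖ f_{k+1} ⊗ ⋯ ⊗ fₙ ⊗ z ⊗ f₁ ⊗ ⋯ ⊗ f_k`, as a function of `z`. -/
def rotSumAux : TensorAlgebra ℂ H →ₗ[ℂ] Module.End ℂ (TensorAlgebra ℂ H) :=
  fockRec 0 (LinearMap.mk₂ ℂ
    (fun f p => LinearMap.mulLeft ℂ (TensorAlgebra.ι ℂ f * p.1) +
      p.2 ∘ₗ LinearMap.mulRight ℂ (TensorAlgebra.ι ℂ f))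
    (by intros; apply LinearMap.ext; intro x; simp [add_mul, mul_add, mul_assoc]; abel)
    (by intros; apply LinearMap.ext; intro x; simp [mul_assoc])
    (by intros; apply LinearMap.ext; intro x; simp [add_mul, mul_add, mul_assoc]; abel)
    (by intros; apply LinearMap.ext; intro x; simp [mul_assoc]))

/-- The sum over all rotations,
`f₁ ⊗ ⋯ ⊗ fₙ ↦ ∑_{0 ≤ k < n} f_{k+1} ⊗ ⋯ ⊗ fₙ ⊗ f₁ ⊗ ⋯ ⊗ f_k`. -/
def rotSum : TensorAlgebra ℂ H →ₗ[ℂ] TensorAlgebra ℂ H := LinearMap.applyₗ 1 ∘ₗ rotSumAux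

lemma rotSumAux_word (l : List H) (z : TensorAlgebra ℂ H) :
    rotSumAux (word l) z =
      ∑ k ∈ Finset.range l.length, word (l.drop k) * z * word (l.take k) := by
  induction l generalizing z with
  | nil => simp [rotSumAux]
  | cons f l ih =>
    have : rotSumAux (word (f :: l)) = LinearMap.mulLeft ℂ (TensorAlgebra.ι ℂ f * word l) +
        (rotSumAux (word l)) ∘ₗ LinearMap.mulRight ℂ (TensorAlgebra.ι ℂ f) := by
      rw [word_cons, rotSumAux, fockRec_ι_mul, LinearMap.mk₂_apply]
    rw [this, LinearMap.add_apply, LinearMap.comp_apply, ih, List.length_cons,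
      Finset.sum_range_succ']
    simp [mul_assoc, add_comm]

lemma rotSum_word (l : List H) :
    rotSum (word l) = ∑ k ∈ Finset.range l.length, word (l.rotate k) := by
  have : rotSum (word l) = rotSumAux (word l) 1 := rfl
  rw [this, rotSumAux_word]
  refine Finset.sum_congr rfl fun k hk => ?_
  rw [mul_one, ← word_append, List.rotate_eq_drop_append_take (Finset.mem_range.1 hk).le]

lemma sum_rotate_rotate {A : Type*} [AddCommGroup A] (F : List H → A) (l : List H) (j : ℕ) :
    ∑ k ∈ Finset.range l.length, F ((l.rotate j).rotate k) =
      ∑ k ∈ Finset.range l.length, F (l.rotate k) := by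
  induction j with
  | zero => simp
  | succ j ih =>
    rw [← ih]
    have h1 : ∀ k, (l.rotate (j + 1)).rotate k = (l.rotate j).rotate (k + 1) := by
      intro k
      simp only [List.rotate_rotate]
      congr 1
      omega
    simp only [h1]
    have h2 := Finset.sum_range_succ' (fun k => F ((l.rotate j).rotate k)) l.length
    rw [Finset.sum_range_succ] at h2
    have h3 : (l.rotate j).rotate l.length = l.rotate j := by
      conv_lhs => rw [← List.length_rotate (l := l) (n := j)]
      exact List.rotate_length _
    rw [h3, List.rotate_zero] at h2
    exact (add_right_cancel h2).symm

lemma rotSum_mul_comm (x y : TensorAlgebra ℂ H) : rotSum (x * y) = rotSum (y * x) := by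
  have h : (LinearMap.mul ℂ (TensorAlgebra ℂ H)).compr₂ rotSum =
      ((LinearMap.mul ℂ (TensorAlgebra ℂ H)).compr₂ rotSum).flip := by
    apply ext_word
    intro l
    apply ext_word
    intro l'
    simp only [LinearMap.compr₂_apply, LinearMap.mul_apply', LinearMap.flip_apply, ← word_append,
      rotSum_word]
    rw [← List.rotate_append_length_eq l l', List.length_rotate, sum_rotate_rotate]
  exact LinearMap.congr_fun₂ h x y

end Fock

/-! ### Inner products and operators over the complexification -/

variable {V : Type*} [NormedAddCommGroup V] [InnerProductSpace ℝ V]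

/-- The algebraic linear Fock space of the complexification of `V`. -/
abbrev LinFock (V : Type*) [NormedAddCommGroup V] [InnerProductSpace ℝ V] :=
  TensorAlgebra ℂ (Cplx V)

/-- The creation operator `l(f)`. -/
def creation (f : Cplx V) : Module.End ℂ (LinFock V) :=
  LinearMap.mulLeft ℂ (TensorAlgebra.ι ℂ f)

/-- The annihilation operator `l*(f)`: `Ω ↦ 0` and
`f₁ ⊗ ⋯ ⊗ fₙ ↦ ⟨f₁, f⟩ f₂ ⊗ ⋯ ⊗ fₙ`. -/
def annihilation (f : Cplx V) : Module.End ℂ (LinFock V) := contractL (Cplx.form.flip f)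

/-- `ω(f) = l(f) + l*(f̄)`. -/
def field (f : Cplx V) : Module.End ℂ (LinFock V) := creation f + annihilation (Cplx.bar f)

/-- The complex unital algebra generated by all `ω(f)` with `f` real. As these operators are
self-adjoint, this is also the unital `*`-algebra which they generate. -/
def fieldAlgebra (V : Type*) [NormedAddCommGroup V] [InnerProductSpace ℝ V] :
    Subalgebra ℂ (Module.End ℂ (LinFock V)) :=
  Algebra.adjoin ℂ (Set.range fun f : V => field (Cplx.ofReal f))

/-- The Wick product `W(f₁ ⊗ ⋯ ⊗ fₙ)`. -/
def wick : List (Cplx V) → Module.End ℂ (LinFock V)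
  | [] => 1
  | [f] => field f
  | f :: g :: l => field f * wick (g :: l) - Cplx.form g (Cplx.bar f) • wick l

/-- The cyclic Wick product
`C(f₁ ⊗ ⋯ ⊗ fₙ) = W(f₁ ⊗ ⋯ ⊗ fₙ) - ⟨f₁, f̄ₙ⟩ W(f₂ ⊗ ⋯ ⊗ fₙ₋₁)` for `n ≥ 2`, `C(f) = ω(f)`.
(The value for `n = 0` is a convention.) -/
def cyclicWick : List (Cplx V) → Module.End ℂ (LinFock V)
  | [] => 1
  | [f] => field f
  | f :: g :: l => wick (f :: g :: l) -
      Cplx.form f (Cplx.bar ((g :: l).getLast (List.cons_ne_nil g l))) • wick (g :: l).dropLast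

/-- `f₁ ⊗ ⋯ ⊗ fₙ ↦ ⟨f₁, f̄ₙ⟩ f₂ ⊗ ⋯ ⊗ fₙ₋₁` for `n ≥ 2`, and `0` on tensors of degree `≤ 1`. -/
def contractEnds : LinFock V →ₗ[ℂ] LinFock V :=
  fockRec 0 (LinearMap.mk₂ ℂ (fun f p => contractR (Cplx.bil f) p.1)
    (by intros; simp [contractR_add]) (by intros; simp [contractR_smul])
    (by intros; simp) (by intros; simp))

lemma contractEnds_one : contractEnds (1 : LinFock V) = 0 := by simp [contractEnds]
lemma contractEnds_single (f : Cplx V) : contractEnds (word [f]) = 0 := by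
  rw [word_cons, contractEnds, fockRec_ι_mul]
  simp
lemma contractEnds_word (f g : Cplx V) (l : List (Cplx V)) :
    contractEnds (word (f :: (l ++ [g]))) = Cplx.form f (Cplx.bar g) • word l := by
  rw [word_cons, contractEnds, fockRec_ι_mul]
  simp [contractR_concat, Cplx.bil_apply]

lemma contractEnds_nilpotent (x : LinFock V) : ∃ n, ∀ j ≥ n, (contractEnds ^ j) x = 0 := by
  have hx : x ∈ Submodule.span ℂ (Set.range (word : List (Cplx V) → LinFock V)) := by
    rw [span_word]; trivial
  induction hx using Submodule.span_induction with
  | mem x hx =>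
    obtain ⟨l, rfl⟩ := hx
    refine ⟨l.length + 1, ?_⟩
    induction hn : l.length using Nat.strong_induction_on generalizing l with
    | _ n ih =>
      intro j hj
      obtain ⟨j, rfl⟩ : ∃ i, j = i + 1 := ⟨j - 1, by omega⟩
      rw [pow_succ, Module.End.mul_apply]
      rcases l with _ | ⟨f, l⟩
      · simp [contractEnds_one]
      · induction l using List.reverseRecOn with
        | nil => rw [contractEnds_single, map_zero]
        | append_singleton l g _ =>
          simp only [List.length_cons, List.length_append, List.length_nil] at hn
          rw [contractEnds_word, map_smul, ih l.length (by omega) l rfl j (by omega), smul_zero]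
  | zero => exact ⟨0, fun j _ => map_zero _⟩
  | add x y _ _ hx hy =>
    obtain ⟨n, hn⟩ := hx
    obtain ⟨m, hm⟩ := hy
    refine ⟨max n m, fun j hj => ?_⟩
    rw [map_add, hn j (le_trans (le_max_left _ _) hj), hm j (le_trans (le_max_right _ _) hj),
      add_zero]
  | smul c x _ hx =>
    obtain ⟨n, hn⟩ := hx
    exact ⟨n, fun j hj => by rw [map_smul, hn j hj, smul_zero]⟩

lemma cyclize_support (x : LinFock V) :
    (Function.support fun j : ℕ => circ₀ ((contractEnds ^ j) x)).Finite := by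
  obtain ⟨n, hn⟩ := contractEnds_nilpotent x
  refine (Set.finite_lt_nat n).subset fun j hj => ?_
  by_contra h
  exact hj (by simp only [hn j (not_lt.1 h), map_zero])

/-- The map `𝐜` from the linear to the cyclic Fock space: the sum of all `[·]` of the iterated
contractions of the two ends, with `𝐜 Ω = 0`. -/
def cyclize : LinFock V →ₗ[ℂ] CycFock (Cplx V) where
  toFun x := ∑ᶠ j : ℕ, circ₀ ((contractEnds ^ j) x)
  map_add' x y := by
    simp only [map_add]
    exact finsum_add_distrib (cyclize_support x) (cyclize_support y)
  map_smul' c x := by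
    simp only [map_smul, RingHom.id_apply]
    exact (smul_finsum' c (cyclize_support x)).symm

lemma cyclize_eq (x : LinFock V) : cyclize x = circ₀ x + cyclize (contractEnds x) := by
  obtain ⟨n, hn⟩ := contractEnds_nilpotent x
  have h1 : cyclize x = ∑ j ∈ Finset.range (n + 1), circ₀ ((contractEnds ^ j) x) := by
    refine finsum_eq_sum_of_support_subset _ fun j hj => ?_
    by_contra h
    simp only [Finset.coe_range, Set.mem_Iio, not_lt] at h
    exact hj (by simp only [hn j (by omega), map_zero])
  have h2 : cyclize (contractEnds x) =
      ∑ j ∈ Finset.range n, circ₀ ((contractEnds ^ j) (contractEnds x)) := by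
    refine finsum_eq_sum_of_support_subset _ fun j hj => ?_
    by_contra h
    simp only [Finset.coe_range, Set.mem_Iio, not_lt] at h
    refine hj ?_
    have := hn (j + 1) (by omega)
    rw [pow_succ, Module.End.mul_apply] at this
    simp only [this, map_zero]
  rw [h1, h2, Finset.sum_range_succ']
  simp only [pow_succ, Module.End.mul_apply, pow_zero, Module.End.one_apply]
  exact add_comm _ _

lemma cyclize_vacuum : cyclize (1 : LinFock V) = 0 := by
  rw [cyclize_eq, contractEnds_one, circ₀_one, map_zero, add_zero]
lemma cyclize_single (f : Cplx V) : cyclize (word [f]) = circWord [f] := by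
  rw [cyclize_eq, contractEnds_single, circ₀_word (by simp), map_zero, add_zero]
lemma cyclize_word (f g : Cplx V) (l : List (Cplx V)) :
    cyclize (word (f :: (l ++ [g]))) =
      circWord (f :: (l ++ [g])) + Cplx.form f (Cplx.bar g) • cyclize (word l) := by
  rw [cyclize_eq, contractEnds_word, circ₀_word (by simp), map_smul]

/-- A complex vector space with the conjugate scalar multiplication. -/
def Conj (M : Type*) := M

instance {M : Type*} [h : AddCommGroup M] : AddCommGroup (Conj M) := h
instance {M : Type*} [AddCommGroup M] [h : Module ℂ M] : Module ℂ (Conj M) :=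
  Module.compHom M (starRingEnd ℂ)

lemma contractL_add {H : Type*} [AddCommGroup H] [Module ℂ H] (φ ψ : H →ₗ[ℂ] ℂ) :
    contractL (φ + ψ) = contractL φ + contractL ψ := by
  apply ext_word
  intro l
  cases l <;> simp [add_smul]

lemma contractL_smul {H : Type*} [AddCommGroup H] [Module ℂ H] (c : ℂ) (φ : H →ₗ[ℂ] ℂ) :
    contractL (c • φ) = c • contractL φ := by
  apply ext_word
  intro l
  cases l <;> simp [mul_smul]

lemma annihilation_add (f g : Cplx V) :
    annihilation (f + g) = annihilation f + annihilation g := by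
  rw [annihilation, map_add, contractL_add]; rfl

lemma annihilation_smul (c : ℂ) (f : Cplx V) :
    annihilation (c • f) = conj c • annihilation f := by
  rw [annihilation, LinearMap.map_smulₛₗ, contractL_smul]; rfl

lemma annihilation_ι_mul (f g : Cplx V) (x : LinFock V) :
    annihilation g (TensorAlgebra.ι ℂ f * x) = Cplx.form f g • x := by
  simp [annihilation]

lemma annihilation_one (g : Cplx V) : annihilation g (1 : LinFock V) = 0 := by
  simp [annihilation]

/-- The step `(g, φ) ↦ φ ∘ l*(g)`, which is antilinear in `g`. -/
def linInnerStep : Cplx V →ₗ[ℂ]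
    (LinFock V × Conj (LinFock V →ₗ[ℂ] ℂ)) →ₗ[ℂ] Conj (LinFock V →ₗ[ℂ] ℂ) :=
  LinearMap.mk₂ ℂ
    (fun g p => ((show LinFock V →ₗ[ℂ] ℂ from p.2) ∘ₗ annihilation g : LinFock V →ₗ[ℂ] ℂ))
    (by
      intro f g p
      rw [annihilation_add]
      exact LinearMap.comp_add (annihilation f) (annihilation g) _)
    (by
      intro c f p
      rw [annihilation_smul]
      exact LinearMap.comp_smul _ _ _)
    (by intros; rfl)
    (by intros; rfl)

/-- `g₁ ⊗ ⋯ ⊗ gₙ ↦ (x ↦ the vacuum coefficient of l*(gₙ) ⋯ l*(g₁) x)`, extended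
antilinearly. -/
def linInnerAux : LinFock V →ₗ[ℂ] Conj (LinFock V →ₗ[ℂ] ℂ) :=
  fockRec (M := Conj (LinFock V →ₗ[ℂ] ℂ)) (vac : LinFock V →ₗ[ℂ] ℂ) linInnerStep

/-- The inner product of the linear Fock space,
`⟨f₁ ⊗ ⋯ ⊗ fₙ, g₁ ⊗ ⋯ ⊗ gₘ⟩ = δₙₘ ⟨f₁, g₁⟩ ⋯ ⟨fₙ, gₙ⟩`, linear in the first and
antilinear in the second argument. -/
def linInner : LinFock V →ₗ[ℂ] LinFock V →ₗ⋆[ℂ] ℂ :=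
  LinearMap.flip
    { toFun := fun y => (show LinFock V →ₗ[ℂ] ℂ from linInnerAux y)
      map_add' := fun x y => map_add linInnerAux x y
      map_smul' := fun c x => map_smul linInnerAux c x }

/-- `⟨f₁, g₁⟩ ⋯ ⟨fₙ, gₙ⟩` for lists of the same length `n`, and `0` otherwise. -/
def listInner : List (Cplx V) → List (Cplx V) → ℂ
  | [], [] => 1
  | f :: l, g :: l' => Cplx.form f g * listInner l l'
  | _, _ => 0

lemma linInner_one (x : LinFock V) : linInner x 1 = vac x := by
  have : linInnerAux (1 : LinFock V) = (vac : LinFock V →ₗ[ℂ] ℂ) := fockRec_one _ _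
  change (show LinFock V →ₗ[ℂ] ℂ from linInnerAux 1) x = _
  rw [this]

lemma linInner_ι_mul (x y : LinFock V) (g : Cplx V) :
    linInner x (TensorAlgebra.ι ℂ g * y) = linInner (annihilation g x) y := by
  have : linInnerAux (TensorAlgebra.ι ℂ g * y) = linInnerStep g (y, linInnerAux y) :=
    fockRec_ι_mul _ _ _ _
  change (show LinFock V →ₗ[ℂ] ℂ from linInnerAux _) x = _
  rw [this]
  rfl

lemma linInner_word (l l' : List (Cplx V)) : linInner (word l) (word l') = listInner l l' := by
  induction l' generalizing l with
  | nil => cases l <;> simp [linInner_one, listInner]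
  | cons g l' ih =>
    cases l with
    | nil => simp [linInner_ι_mul, annihilation_one, listInner]
    | cons f l => simp [linInner_ι_mul, annihilation_ι_mul, listInner, ih]

lemma listInner_of_length_ne {l l' : List (Cplx V)} (h : l.length ≠ l'.length) :
    listInner l l' = 0 := by
  induction l generalizing l' with
  | nil => cases l' <;> simp_all [listInner]
  | cons f l ih =>
    cases l' with
    | nil => simp [listInner]
    | cons g l' => simp only [listInner]; rw [ih (by simpa using h), mul_zero]

lemma listInner_concat {l l' : List (Cplx V)} (h : l.length = l'.length) (f g : Cplx V) :
    listInner (l ++ [f]) (l' ++ [g]) = listInner l l' * Cplx.form f g := by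
  induction l generalizing l' with
  | nil => cases l' <;> simp_all [listInner]
  | cons f l ih =>
    cases l' with
    | nil => simp at h
    | cons g l' => simp only [List.cons_append, listInner, ih (by simpa using h), mul_assoc]

lemma listInner_rotate (l l' : List (Cplx V)) (k : ℕ) :
    listInner (l.rotate k) (l'.rotate k) = listInner l l' := by
  by_cases h : l.length = l'.length
  · induction k with
    | zero => simp
    | succ k ih =>
      rw [← List.rotate_rotate, ← List.rotate_rotate, ← ih]
      have h' : (l.rotate k).length = (l'.rotate k).length := by simpa using h
      generalize l.rotate k = a at h'
      generalize l'.rotate k = b at h'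
      cases a <;> cases b
      · rfl
      · simp at h'
      · simp at h'
      · rw [List.rotate_cons_succ, List.rotate_cons_succ, List.rotate_zero, List.rotate_zero,
          listInner_concat (by simpa using h'), listInner, mul_comm]
  · rw [listInner_of_length_ne h, listInner_of_length_ne (by simpa using h)]

lemma linInner_rotSum (x y : LinFock V) : linInner x (rotSum y) = linInner (rotSum x) y := by
  have h : linInner.compl₂ (rotSum : LinFock V →ₗ[ℂ] LinFock V) = linInner ∘ₗ rotSum := by
    apply ext_word
    intro l
    apply ext_word
    intro l'
    simp only [LinearMap.compl₂_apply, LinearMap.comp_apply, rotSum_word, map_sum,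
      LinearMap.sum_apply, linInner_word]
    by_cases h : l.length = l'.length
    · rw [← h]
      have hl : l.rotate l.length = l := List.rotate_length l
      have hl' : l'.rotate l.length = l' := by rw [h]; exact List.rotate_length l'
      have h1 : ∀ k ∈ Finset.range l.length,
          listInner l (l'.rotate k) = listInner (l.rotate (l.length - k)) l' := by
        intro k hk
        rw [← listInner_rotate l (l'.rotate k) (l.length - k), List.rotate_rotate,
          Nat.add_sub_cancel' (Finset.mem_range.1 hk).le, hl']
      rw [Finset.sum_congr rfl h1]
      have h2 := Finset.sum_range_succ (fun k => listInner (l.rotate (l.length - k)) l') l.length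
      have h3 := Finset.sum_range_reflect (fun k => listInner (l.rotate k) l') (l.length + 1)
      have h4 := Finset.sum_range_succ (fun k => listInner (l.rotate k) l') l.length
      simp only [Nat.add_sub_cancel_right] at h3
      rw [h3, h4, hl, Nat.sub_self, List.rotate_zero] at h2
      exact (add_right_cancel h2).symm
    · rw [Finset.sum_eq_zero, Finset.sum_eq_zero]
      · intro k _; exact listInner_of_length_ne (by simpa using h)
      · intro k _; exact listInner_of_length_ne (by simpa using h)
  exact LinearMap.congr_fun (LinearMap.congr_fun h x) y

lemma vac_mul_comm (x y : LinFock V) : vac (x * y) = vac (y * x) := by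
  simp [vac, mul_comm]

/-- `(x, y) ↦ ⟨[x], [y]⟩_cyc`. -/
def cycInnerAux : LinFock V →ₗ[ℂ] LinFock V →ₗ⋆[ℂ] ℂ :=
  LinearMap.mk₂'ₛₗ (RingHom.id ℂ) (starRingEnd ℂ)
    (fun x y => linInner x (rotSum y) + vac x * conj (vac y))
    (by intros; simp only [map_add, LinearMap.add_apply]; ring)
    (by intros; simp only [map_smul, LinearMap.smul_apply, smul_eq_mul, RingHom.id_apply]; ring)
    (by intros; simp only [map_add]; ring)
    (by intros; simp only [map_smul, LinearMap.map_smulₛₗ, smul_eq_mul, map_mul]; ring)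

lemma cycInnerAux_apply (x y : LinFock V) :
    cycInnerAux x y = linInner x (rotSum y) + vac x * conj (vac y) := rfl

/-- The inner product of the cyclic Fock space, the sesquilinear extension of
`⟨[f₁ ⊗ ⋯ ⊗ fₙ], [g₁ ⊗ ⋯ ⊗ gₘ]⟩ = δₙₘ ∑_{0 ≤ k < n} ⟨f₁, g_{1+k}⟩ ⋯ ⟨fₙ, g_{n+k}⟩` (indices of
`g` modulo `n`), the vacuum being a unit vector orthogonal to everything else. -/
def cycInner : CycFock (Cplx V) →ₗ[ℂ] CycFock (Cplx V) →ₗ⋆[ℂ] ℂ :=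
  (commutators (Cplx V)).liftQ
    (LinearMap.flip ((commutators (Cplx V)).liftQ cycInnerAux.flip (by
      refine Submodule.span_le.2 ?_
      rintro _ ⟨x, y, rfl⟩
      rw [SetLike.mem_coe, LinearMap.mem_ker, map_sub, sub_eq_zero]
      ext z
      simp only [LinearMap.flip_apply, cycInnerAux_apply, rotSum_mul_comm x y,
        vac_mul_comm x y])))
    (by
      refine Submodule.span_le.2 ?_
      rintro _ ⟨x, y, rfl⟩
      rw [SetLike.mem_coe, LinearMap.mem_ker, map_sub, sub_eq_zero]
      ext z
      change cycInnerAux (x * y) z = cycInnerAux (y * x) z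
      simp only [cycInnerAux_apply, linInner_rotSum, rotSum_mul_comm x y, vac_mul_comm x y])

lemma cycInner_circ (x y : LinFock V) : cycInner (circ x) (circ y) = cycInnerAux x y := rfl

lemma cycInner_circWord (l : List (Cplx V)) {l' : List (Cplx V)} (hl' : l' ≠ []) :
    cycInner (circWord l) (circWord l') =
      ∑ k ∈ Finset.range l'.length, listInner l (l'.rotate k) := by
  have h0 : vac (word l') = 0 := by
    cases l' with
    | nil => exact absurd rfl hl'
    | cons f l => simp
  simp only [circWord, cycInner_circ, cycInnerAux_apply, rotSum_word, map_sum, linInner_word, h0,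
    map_zero, mul_zero, add_zero]

lemma listInner_ofFn {n : ℕ} (f g : Fin n → Cplx V) :
    listInner (List.ofFn f) (List.ofFn g) = ∏ i, Cplx.form (f i) (g i) := by
  induction n with
  | zero => simp [listInner]
  | succ n ih => rw [List.ofFn_succ, List.ofFn_succ, listInner, ih, Fin.prod_univ_succ]

/-- The defining formula of the cyclic inner product for tensors of the same degree `n ≥ 1`. -/
lemma cycInner_ofFn {n : ℕ} [NeZero n] (f g : Fin n → Cplx V) :
    cycInner (circWord (List.ofFn f)) (circWord (List.ofFn g)) =
      ∑ k : Fin n, ∏ i : Fin n, Cplx.form (f i) (g (i + k)) := by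
  have hg : List.ofFn g ≠ [] := by
    intro h
    exact NeZero.ne n (List.ofFn_eq_nil_iff.1 h)
  rw [cycInner_circWord _ hg, List.length_ofFn, Finset.sum_range]
  refine Finset.sum_congr rfl fun k _ => ?_
  have : (List.ofFn g).rotate k = List.ofFn fun i => g (i + k) := by
    apply List.ext_getElem
    · simp
    · intro i h1 h2
      simp only [List.getElem_rotate, List.getElem_ofFn, List.length_ofFn]
      congr 1
  rw [this, listInner_ofFn]

/-- Tensors of different degrees are orthogonal. -/
lemma cycInner_of_length_ne {l l' : List (Cplx V)} (h : l.length ≠ l'.length) :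
    cycInner (circWord l) (circWord l') = 0 := by
  by_cases hl' : l' = []
  · subst hl'
    cases l with
    | nil => exact absurd rfl h
    | cons f l =>
      simp only [circWord, cycInner_circ, cycInnerAux_apply, rotSum_word]
      simp
  · rw [cycInner_circWord _ hl']
    exact Finset.sum_eq_zero fun k _ => listInner_of_length_ne (by simpa using h)

/-! ### Words, Chebyshev polynomials and random matrices -/

/-- The elementary tensor `f^{⊗ n}` as a list of factors. -/
def power (f : V) (n : ℕ) : List (Cplx V) := List.replicate n (Cplx.ofReal f)

/-- The elementary tensor `f₁^{⊗ n(1)} ⊗ ⋯ ⊗ f_k^{⊗ n(k)}` as a list of factors. -/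
def blocks {k : ℕ} (f : Fin k → V) (n : Fin k → ℕ) : List (Cplx V) :=
  (List.ofFn fun i => power (f i) (n i)).flatten

/-- The polynomial `V_n(x) = U_n(x/2)`. -/
def polyV (n : ℕ) : Polynomial ℂ :=
  (Polynomial.Chebyshev.U ℂ n).comp (Polynomial.C (1 / 2) * Polynomial.X)

/-- The polynomial `2 T_n(x/2)`. -/
def polyT (n : ℕ) : Polynomial ℂ :=
  2 * (Polynomial.Chebyshev.T ℂ n).comp (Polynomial.C (1 / 2) * Polynomial.X)

/-- A family `(X(f))_f` of Hermitian Gaussian `N × N` random matrices indexed by a real inner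
product space: the entries form a centered (jointly) Gaussian family with
`E{x_ij(f) x_kl(g)} = 0` for `i < j`, `k < l` and
`E{x_ij(f) conj(x_kl(g))} = δ_ik δ_jl ⟨f, g⟩ / N` for `i ≤ j`, `k ≤ l`. -/
structure IsHermitianGaussianFamily {N : ℕ} {Ω : Type*} [MeasurableSpace Ω] (P : Measure Ω)
    (X : V → Ω → Matrix (Fin N) (Fin N) ℂ) : Prop where
  hermitian : ∀ f, ∀ᵐ a ∂P, (X f a).IsHermitian
  gaussian : IsGaussianProcess (fun (t : V × Fin N × Fin N) (a : Ω) => X t.1 a t.2.1 t.2.2) P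
  centered : ∀ f i j, ∫ a, X f a i j ∂P = 0
  cov_self : ∀ f g i j k l, i < j → k < l → ∫ a, X f a i j * X g a k l ∂P = 0
  cov_conj : ∀ f g i j k l, i ≤ j → k ≤ l →
    ∫ a, X f a i j * conj (X g a k l) ∂P =
      if i = k ∧ j = l then ((inner ℝ f g : ℝ) : ℂ) / N else 0

/-- The second cumulant `k₂{A, B} = E{AB} - E{A} E{B}` of complex random variables. -/
def cumulant₂ {Ω : Type*} [MeasurableSpace Ω] (P : Measure Ω) (A B : Ω → ℂ) : ℂ :=
  ∫ a, A a * B a ∂P - (∫ a, A a ∂P) * ∫ a, B a ∂P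

/-- `Tr[V_{n(1)}(X(f₁)) ⋯ V_{n(k)}(X(f_k))]`. -/
def traceV {N : ℕ} {Ω : Type*} (X : V → Ω → Matrix (Fin N) (Fin N) ℂ) {k : ℕ} (f : Fin k → V)
    (n : Fin k → ℕ) (a : Ω) : ℂ :=
  (List.ofFn fun i => Polynomial.aeval (X (f i) a) (polyV (n i))).prod.trace

/-- `Tr[2 T_n(X(f)/2)]`. -/
def traceT {N : ℕ} {Ω : Type*} (X : V → Ω → Matrix (Fin N) (Fin N) ℂ) (f : V) (n : ℕ)
    (a : Ω) : ℂ :=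
  (Polynomial.aeval (X f a) (polyT n)).trace

/-- The random variables `A N`, `B N` are square integrable and
`lim_{N → ∞} k₂{A N, B N} = c`. -/
def HasLimitCovariance {Ω : ℕ → Type*} [∀ N, MeasurableSpace (Ω N)] (P : ∀ N, Measure (Ω N))
    (A B : ∀ N, Ω N → ℂ) (c : ℂ) : Prop :=
  (∀ N, MemLp (A N) 2 (P N) ∧ MemLp (B N) 2 (P N)) ∧
    Tendsto (fun N => cumulant₂ (P N) (A N) (B N)) atTop (𝓝 c)

/-- The cyclic neighbours are orthogonal: `f₁ ⊥ f₂`, …, `f_{k-1} ⊥ f_k`, `f_k ⊥ f₁`. -/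
def CyclicallyOrthogonal {k : ℕ} (f : Fin k → V) : Prop :=
  ∀ i, inner ℝ (f i) (f (finRotate k i)) = 0

end

end CyclicFock

open CyclicFock

namespace CyclicFock

/-! Wick words make sense in any algebra containing elements indexed by `V`. Their identities are
therefore proved once and used for field operators, for the free algebra, for matrices of
indeterminates and for sampled random matrices. On powers of one unit vector the recursion is the
Chebyshev recursion. Multiplying two Wick words contracts the two letters that meet
(`wickIn_concat_mul_wickIn_cons`), so orthogonal neighbouring blocks factor, and orthogonality
across the ends removes the correction in the cyclic word. On the Fock space, uniqueness holds
because the vacuum is separating: the field algebra commutes with right field operators, which build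
all words from the vacuum (`eq_zero_of_apply_one`).

For random matrices, Gaussian integration by parts gives the Schwinger–Dyson equation
(`IsGaussianFunctional.trace_mul`). For plain words it lowers the total degree by two, so by
induction all normalized expected traces and all centered moments of traces stay bounded
(`isBdd_moments`). Expectations of products of two traces then factor to leading order. Hence `1/N *
E Tr W(u)` tends to `0` for nonempty `u`, and `1/N * E Tr (W(u) W(v))` tends to the inner product of
`u` with the reversal of `v`.

For the covariance of `Tr C(f u)` and `Tr C(w)`, integrate the letter `f` by parts. Three kinds of
terms appear. Third centered moments carry `1/N` and vanish. Covariances carry `1/N * E Tr W(a)`,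
which survives only for empty `a`; what survives is cancelled by the two contractions by which `C(f
u)` differs from `X(f) W(u)`. What remains is `1/N * E Tr (W(u) D)`, with `D` the cyclic derivative
of `C(w)` in the direction `f`. This derivative is a sum of single Wick words `W(b a)` over the
splittings `w = a g b` (`cyclic_derivative_cyclicIn`). The limit is thus the sum of `⟨f, g⟩ ⟨u,
reversal of b a⟩`, which is the sum over rotations defining the cyclic inner product of `f u` with
the reversal of `w`. -/

/-! ### Wick words over an arbitrary algebra -/

section WickIn

variable {V : Type*} [NormedAddCommGroup V] [InnerProductSpace ℝ V]
variable {B : Type*} [Ring B] [Algebra ℂ B]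

/-- The Wick word `W(f₁ ⊗ ⋯ ⊗ fₙ)` in a family `ξ` of elements of an algebra. -/
def wickIn (ξ : V → B) : List V → B
  | [] => 1
  | [f] => ξ f
  | f :: g :: l => ξ f * wickIn ξ (g :: l) - ((inner ℝ f g : ℝ) : ℂ) • wickIn ξ l

/-- The cyclic Wick word `C(f₁ ⊗ ⋯ ⊗ fₙ)` in a family `ξ` of elements of an algebra. -/
def cyclicIn (ξ : V → B) : List V → B
  | [] => 1
  | [f] => ξ f
  | f :: g :: l => wickIn ξ (f :: g :: l) -
      ((inner ℝ f ((g :: l).getLast (List.cons_ne_nil g l)) : ℝ) : ℂ) •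
        wickIn ξ (g :: l).dropLast

variable (ξ : V → B)

@[simp] lemma wickIn_nil : wickIn ξ [] = 1 := rfl
@[simp] lemma wickIn_singleton (f : V) : wickIn ξ [f] = ξ f := rfl
lemma wickIn_cons_cons (f g : V) (l : List V) :
    wickIn ξ (f :: g :: l) =
      ξ f * wickIn ξ (g :: l) - ((inner ℝ f g : ℝ) : ℂ) • wickIn ξ l := rfl

lemma mul_wickIn_cons (f g : V) (l : List V) :
    ξ f * wickIn ξ (g :: l) =
      wickIn ξ (f :: g :: l) + ((inner ℝ f g : ℝ) : ℂ) • wickIn ξ l := by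
  rw [wickIn_cons_cons]; abel

/-- Exposes both end letters at once, in place of the `getLast` and `dropLast` of the definition;
the later arguments about cyclic words use this form. -/
lemma cyclicIn_cons_concat (f h : V) (l : List V) :
    cyclicIn ξ (f :: (l ++ [h])) =
      wickIn ξ (f :: (l ++ [h])) - ((inner ℝ f h : ℝ) : ℂ) • wickIn ξ l := by
  cases l with
  | nil => simp [cyclicIn]
  | cons g l =>
    rw [List.cons_append, cyclicIn]
    simp only [← List.cons_append, List.getLast_append_singleton, List.dropLast_concat]

/-- Multiplication of Wick words: contract the two letters which meet. -/
lemma wickIn_concat_mul_wickIn_cons (b a : List V) (x y : V) :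
    wickIn ξ (b ++ [x]) * wickIn ξ (y :: a) =
      wickIn ξ (b ++ x :: y :: a) + ((inner ℝ x y : ℝ) : ℂ) • (wickIn ξ b * wickIn ξ a) := by
  induction hn : b.length using Nat.strong_induction_on generalizing b with
  | _ n ih =>
    match b with
    | [] => simp [mul_wickIn_cons]
    -- Here the recursion contracts `h` with the junction letter `x` itself, so this case does not
    -- fit the general step.
    | [h] =>
      simp only [List.cons_append, List.nil_append, wickIn_cons_cons, wickIn_singleton,
        wickIn_nil, sub_mul, mul_sub, smul_mul_assoc, mul_smul_comm, one_mul, mul_assoc]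
      abel
    -- The recursion removes one or two letters at the front, away from the junction, so the
    -- hypothesis is needed for both `h' :: t` and `t`.
    | h :: h' :: t =>
      have h1 := ih (t.length + 1) (by simp [← hn]) (h' :: t) rfl
      have h2 := ih t.length (by simp [← hn]) t rfl
      simp only [List.cons_append] at h1 h2 ⊢
      rw [wickIn_cons_cons, wickIn_cons_cons ξ h h' (t ++ x :: y :: a), wickIn_cons_cons ξ h h' t,
        sub_mul, mul_assoc, h1, smul_mul_assoc, h2]
      simp only [mul_add, mul_smul_comm, sub_mul, smul_add, smul_sub, smul_mul_assoc, mul_assoc,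
        smul_comm ((inner ℝ h h' : ℝ) : ℂ)]
      abel

lemma wickIn_append_of_inner_eq_zero (b a : List V) {x y : V} (h : inner ℝ x y = 0) :
    wickIn ξ (b ++ x :: y :: a) = wickIn ξ (b ++ [x]) * wickIn ξ (y :: a) := by
  rw [wickIn_concat_mul_wickIn_cons, h]; simp

/-- Transports Wick words from the free algebra to matrices of indeterminates and to the values of
the random matrices. -/
lemma map_wickIn {B' : Type*} [Ring B'] [Algebra ℂ B'] (φ : B →ₐ[ℂ] B') (l : List V) :
    φ (wickIn ξ l) = wickIn (φ ∘ ξ) l := by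
  induction hn : l.length using Nat.strong_induction_on generalizing l with
  | _ n ih =>
    match l with
    | [] => simp
    | [f] => simp
    | f :: g :: l =>
      rw [wickIn_cons_cons, wickIn_cons_cons, map_sub, map_mul, map_smul,
        ih _ (by simp [← hn]) (g :: l) rfl, ih l.length (by simp [← hn]) l rfl]
      rfl

lemma map_cyclicIn {B' : Type*} [Ring B'] [Algebra ℂ B'] (φ : B →ₐ[ℂ] B') (l : List V) :
    φ (cyclicIn ξ l) = cyclicIn (φ ∘ ξ) l := by
  match l with
  | [] => simp [cyclicIn]
  | [f] => simp [cyclicIn]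
  | f :: g :: l => simp only [cyclicIn, map_sub, map_smul, map_wickIn]

lemma inner_self_of_norm_eq_one {f : V} (hf : ‖f‖ = 1) : inner ℝ f f = (1 : ℝ) := by
  rw [real_inner_self_eq_norm_sq, hf, one_pow]

/-- The Wick word of a power of a unit vector is a Chebyshev polynomial of the second kind. -/
lemma wickIn_replicate {f : V} (hf : ‖f‖ = 1) (n : ℕ) :
    wickIn ξ (List.replicate n f) =
      Polynomial.aeval ((1 / 2 : ℂ) • ξ f) (Polynomial.Chebyshev.U ℂ n) := by
  induction n using Nat.strong_induction_on with
  | _ n ih =>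
    match n with
    | 0 => simp
    | 1 =>
      simp only [List.replicate_one, wickIn_singleton, Nat.cast_one, Polynomial.Chebyshev.U_one,
        map_mul, Polynomial.aeval_X, map_ofNat]
      rw [← map_ofNat (algebraMap ℂ B) 2, ← Algebra.smul_def, smul_smul]
      norm_num
    | n + 2 =>
      rw [List.replicate_succ, List.replicate_succ, wickIn_cons_cons, ← List.replicate_succ,
        ih (n + 1) (by omega), ih n (by omega), inner_self_of_norm_eq_one hf]
      have := Polynomial.Chebyshev.U_add_two ℂ (n : ℤ)
      push_cast
      rw [this]
      simp only [map_sub, map_mul, Polynomial.aeval_X, map_ofNat]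
      rw [← map_ofNat (algebraMap ℂ B) 2, ← Algebra.smul_def, smul_smul]
      norm_num

/-- The cyclic Wick word of a power of a unit vector is a Chebyshev polynomial of the first
kind. -/
lemma cyclicIn_replicate {f : V} (hf : ‖f‖ = 1) {n : ℕ} (hn : 1 ≤ n) :
    cyclicIn ξ (List.replicate n f) =
      (2 : ℂ) • Polynomial.aeval ((1 / 2 : ℂ) • ξ f) (Polynomial.Chebyshev.T ℂ n) := by
  match n, hn with
  | 1, _ =>
    simp [cyclicIn]
  | n + 2, _ =>
    have h : List.replicate (n + 2) f = f :: (List.replicate n f ++ [f]) := by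
      rw [← List.replicate_succ', ← List.replicate_succ]
    have h' : f :: (List.replicate n f ++ [f]) = List.replicate (n + 2) f := h.symm
    rw [h, cyclicIn_cons_concat, h', wickIn_replicate ξ hf, wickIn_replicate ξ hf,
      inner_self_of_norm_eq_one hf]
    have h1 := Polynomial.Chebyshev.T_eq_U_sub_X_mul_U ℂ ((n : ℤ) + 2)
    have h2 := Polynomial.Chebyshev.U_add_two ℂ (n : ℤ)
    -- Eliminating `X * U (n + 1)` between `h1` and `h2` leaves `U (n + 2) - U n`, and the
    -- correction in the cyclic word, which drops both end letters, supplies exactly the second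
    -- term.
    have h3 : (2 : Polynomial ℂ) * Polynomial.Chebyshev.T ℂ ((n : ℤ) + 2) =
        Polynomial.Chebyshev.U ℂ ((n : ℤ) + 2) - Polynomial.Chebyshev.U ℂ (n : ℤ) := by
      have e : ((n : ℤ) + 2 - 1) = (n : ℤ) + 1 := by ring
      rw [h1, e, h2]; ring
    have h4 := congrArg (Polynomial.aeval ((1 / 2 : ℂ) • ξ f)) h3
    simp only [map_mul, map_sub, map_ofNat] at h4
    rw [← map_ofNat (algebraMap ℂ B) 2, ← Algebra.smul_def] at h4
    push_cast
    rw [one_smul]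
    exact h4.symm

/-! ### Words made of blocks of powers. -/

/-- `f₁^{⊗ n(1)} ⊗ ⋯ ⊗ f_k^{⊗ n(k)}` as a list of real vectors. -/
def realBlocks {k : ℕ} (f : Fin k → V) (n : Fin k → ℕ) : List V :=
  (List.ofFn fun i => List.replicate (n i) (f i)).flatten

lemma realBlocks_succ {k : ℕ} (f : Fin (k + 1) → V) (n : Fin (k + 1) → ℕ) :
    realBlocks f n = List.replicate (n 0) (f 0) ++
      realBlocks (fun i => f i.succ) (fun i => n i.succ) := by
  simp [realBlocks, List.ofFn_succ]

lemma realBlocks_castSucc {k : ℕ} (f : Fin (k + 1) → V) (n : Fin (k + 1) → ℕ) :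
    realBlocks f n = realBlocks (fun i => f i.castSucc) (fun i => n i.castSucc) ++
      List.replicate (n (Fin.last k)) (f (Fin.last k)) := by
  rw [realBlocks, List.ofFn_succ', List.concat_eq_append, List.flatten_append]
  simp [realBlocks]

lemma blocks_eq_map_realBlocks {k : ℕ} (f : Fin k → V) (n : Fin k → ℕ) :
    blocks f n = (realBlocks f n).map Cplx.ofReal := by
  simp [blocks, realBlocks, power, List.map_flatten, List.map_ofFn, Function.comp_def]

/-- Accounts for the reversed order of the second tensor in the limit covariance. -/
lemma reverse_realBlocks {k : ℕ} (f : Fin k → V) (n : Fin k → ℕ) :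
    (realBlocks f n).reverse = realBlocks (fun j => f j.rev) (fun j => n j.rev) := by
  induction k with
  | zero => simp [realBlocks]
  | succ k ih =>
    rw [realBlocks_succ, realBlocks_castSucc, List.reverse_append, ih, List.reverse_replicate]
    simp [Fin.rev_castSucc]

lemma realBlocks_ne_nil {k : ℕ} {f : Fin k → V} {n : Fin k → ℕ} (hk : 0 < k)
    (hn : ∀ i, 0 < n i) : realBlocks f n ≠ [] := by
  obtain ⟨k, rfl⟩ : ∃ j, k = j + 1 := ⟨k - 1, by omega⟩
  rw [realBlocks_succ]
  simp [(hn 0).ne']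

/-- Wick words over blocks with orthogonal neighbours factor. -/
lemma wickIn_realBlocks {k : ℕ} (f : Fin k → V) (n : Fin k → ℕ) (hn : ∀ i, 0 < n i)
    (h : ∀ i j : Fin k, (i : ℕ) + 1 = j → inner ℝ (f i) (f j) = 0) :
    wickIn ξ (realBlocks f n) =
      (List.ofFn fun i => wickIn ξ (List.replicate (n i) (f i))).prod := by
  induction k with
  | zero => simp [realBlocks]
  | succ k ih =>
    rw [realBlocks_succ, List.ofFn_succ, List.prod_cons,
      ← ih (fun i => f i.succ) (fun i => n i.succ) (fun i => hn _)
        (fun i j hij => h _ _ (by simp [← hij]))]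
    cases k with
    | zero => simp [realBlocks]
    | succ k =>
      -- Positive exponents allow the last letter of the first block and the first letter of the
      -- second to be split off; their orthogonality cuts the Wick word at this place.
      obtain ⟨p, hp⟩ : ∃ p, n 0 = p + 1 := ⟨n 0 - 1, by have := hn 0; omega⟩
      obtain ⟨q, hq⟩ : ∃ q, n 1 = q + 1 := ⟨n 1 - 1, by have := hn 1; omega⟩
      have h01 : inner ℝ (f 0) (f 1) = 0 := h 0 1 (by simp)
      rw [realBlocks_succ]
      have e1 : n (Fin.succ 0) = q + 1 := hq
      have e2 : f (Fin.succ 0) = f 1 := rfl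
      simp only [e1, e2]
      rw [hp, List.replicate_succ (n := q), List.replicate_succ' (n := p), List.cons_append,
        List.append_assoc, List.singleton_append]
      exact wickIn_append_of_inner_eq_zero ξ _ _ h01

lemma CyclicallyOrthogonal.inner_succ {k : ℕ} {f : Fin k → V} (h : CyclicallyOrthogonal f)
    (i j : Fin k) (hij : (i : ℕ) + 1 = j) : inner ℝ (f i) (f j) = 0 := by
  cases k with
  | zero => exact i.elim0
  | succ k =>
    have := h i
    rwa [show finRotate (k + 1) i = j from ?_] at this
    apply Fin.ext
    rw [coe_finRotate_of_ne_last, hij]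
    rintro rfl
    have := j.2
    simp at hij
    omega

/-- The wrap-around condition, which kills the correction term of a cyclic word. For a single vector
it forces that vector to vanish. -/
lemma CyclicallyOrthogonal.inner_last_zero {k : ℕ} {f : Fin (k + 1) → V}
    (h : CyclicallyOrthogonal f) : inner ℝ (f 0) (f (Fin.last k)) = 0 := by
  have := h (Fin.last k)
  rwa [finRotate_last, real_inner_comm] at this

/-- For cyclically orthogonal blocks the cyclic Wick word is the Wick word. -/
lemma cyclicIn_realBlocks {k : ℕ} (f : Fin k → V) (n : Fin k → ℕ) (hn : ∀ i, 0 < n i)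
    (h : CyclicallyOrthogonal f) :
    cyclicIn ξ (realBlocks f n) = wickIn ξ (realBlocks f n) := by
  cases k with
  | zero => simp [realBlocks, cyclicIn]
  | succ k =>
    obtain ⟨p, hp⟩ : ∃ p, n 0 = p + 1 := ⟨n 0 - 1, by have := hn 0; omega⟩
    obtain ⟨q, hq⟩ : ∃ q, n (Fin.last k) = q + 1 :=
      ⟨n (Fin.last k) - 1, by have := hn (Fin.last k); omega⟩
    have h1 := realBlocks_succ f n
    have h2 := realBlocks_castSucc f n
    rw [hp, List.replicate_succ, List.cons_append] at h1
    rw [hq, List.replicate_succ', ← List.append_assoc] at h2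
    -- Only the two end letters matter from here on. An empty `b` means that the word has one
    -- letter, for which the cyclic word has no correction.
    generalize realBlocks f n = w at h1 h2
    generalize List.replicate p (f 0) ++ _ = a at h1
    generalize realBlocks _ _ ++ List.replicate q _ = b at h2
    cases b with
    | nil =>
      simp only [List.nil_append] at h2
      subst h2
      simp [cyclicIn]
    | cons c b =>
      have h3 := h1.symm.trans h2
      simp only [List.cons_append, List.cons.injEq] at h3
      rw [h1, h3.2, cyclicIn_cons_concat, h.inner_last_zero]
      simp

end WickIn

/-! ### Wick products on the Fock space -/

section FockWick

variable {V : Type*} [NormedAddCommGroup V] [InnerProductSpace ℝ V]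

lemma form_ofReal (f g : V) : Cplx.form (Cplx.ofReal f) (Cplx.ofReal g) = ((inner ℝ f g : ℝ) : ℂ) := by
  apply Complex.ext <;> simp [Cplx.form_apply, Cplx.ofReal]

lemma bar_ofReal (f : V) : Cplx.bar (Cplx.ofReal f) = Cplx.ofReal f := by
  ext <;> simp [Cplx.bar, Cplx.ofReal]

/-- On real vectors the involution is trivial and the form is the real inner product, whose symmetry
absorbs the different order of arguments in the two recursions. -/
lemma wick_map_ofReal (l : List V) :
    wick (l.map Cplx.ofReal) = wickIn (fun f : V => field (Cplx.ofReal f)) l := by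
  induction hn : l.length using Nat.strong_induction_on generalizing l with
  | _ n ih =>
    match l with
    | [] => rfl
    | [f] => rfl
    | f :: g :: l =>
      have h1 := ih _ (by simp [← hn]) (g :: l) rfl
      have h2 := ih l.length (by simp [← hn]) l rfl
      simp only [List.map_cons] at h1 ⊢
      rw [wick, h1, h2, bar_ofReal, form_ofReal, wickIn_cons_cons, real_inner_comm]

lemma cyclicWick_map_ofReal (l : List V) :
    cyclicWick (l.map Cplx.ofReal) = cyclicIn (fun f : V => field (Cplx.ofReal f)) l := by
  match l with
  | [] => rfl
  | [f] => rfl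
  | f :: g :: l =>
    have h1 := wick_map_ofReal (f :: g :: l)
    have h2 := wick_map_ofReal (g :: l).dropLast
    rw [List.map_dropLast] at h2
    simp only [List.map_cons] at h1 h2 ⊢
    rw [cyclicWick, cyclicIn, h1, h2]
    have h3 : (Cplx.ofReal g :: l.map Cplx.ofReal).getLast (List.cons_ne_nil _ _) =
        Cplx.ofReal ((g :: l).getLast (List.cons_ne_nil _ _)) := by
      have := List.getLast_map (f := (Cplx.ofReal : V → Cplx V)) (l := g :: l) (h := by simp)
      simpa only [List.map_cons] using this
    rw [h3, bar_ofReal, form_ofReal]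

lemma power_eq_map (f : V) (n : ℕ) : power f n = (List.replicate n f).map Cplx.ofReal := by
  simp [power]

lemma field_ι_mul (f g : Cplx V) (x : LinFock V) :
    field f (TensorAlgebra.ι ℂ g * x) =
      TensorAlgebra.ι ℂ f * (TensorAlgebra.ι ℂ g * x) + Cplx.form g (Cplx.bar f) • x := by
  simp [field, creation, annihilation_ι_mul]

lemma field_one (f : Cplx V) : field f (1 : LinFock V) = TensorAlgebra.ι ℂ f := by
  simp [field, creation, annihilation_one]

/-- The annihilation part of `field f` contracts the next letter, and the recursion subtracts
exactly this contraction, so that only the creation part remains. -/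
lemma wick_apply_one (l : List (Cplx V)) : wick l 1 = word l := by
  induction hn : l.length using Nat.strong_induction_on generalizing l with
  | _ n ih =>
    match l with
    | [] => rfl
    | [f] => simp [wick, field_one]
    | f :: g :: l =>
      rw [wick, LinearMap.sub_apply, Module.End.mul_apply, LinearMap.smul_apply,
        ih _ (by simp [← hn]) (g :: l) rfl, ih l.length (by simp [← hn]) l rfl, word_cons,
        field_ι_mul, word_cons, word_cons]
      abel

lemma bar_add (f g : Cplx V) : Cplx.bar (f + g) = Cplx.bar f + Cplx.bar g := by
  ext <;> simp [Cplx.bar]; abel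

lemma bar_smul (c : ℂ) (f : Cplx V) : Cplx.bar (c • f) = conj c • Cplx.bar f := by
  ext <;> simp [Cplx.bar]; abel

lemma field_add (f g : Cplx V) : field (f + g) = field f + field g := by
  ext x
  simp [field, creation, bar_add, annihilation_add, add_mul]
  abel

lemma field_smul (c : ℂ) (f : Cplx V) : field (c • f) = c • field f := by
  apply LinearMap.ext
  intro x
  simp [field, creation, bar_smul, annihilation_smul, smul_add]

/-- The generators are real, but `field` is complex linear: the conjugation in `Cplx.bar`
compensates the antilinearity of annihilation. -/
lemma field_mem_fieldAlgebra (f : Cplx V) : field f ∈ fieldAlgebra V := by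
  have hf : f = Cplx.ofReal f.re + Complex.I • Cplx.ofReal f.im := by
    ext <;> simp [Cplx.ofReal]
  rw [hf, field_add, field_smul]
  exact add_mem (Algebra.subset_adjoin (Set.mem_range_self f.re))
    (Subalgebra.smul_mem _ (Algebra.subset_adjoin (Set.mem_range_self f.im)) _)

lemma wick_mem_fieldAlgebra (l : List (Cplx V)) : wick l ∈ fieldAlgebra V := by
  induction hn : l.length using Nat.strong_induction_on generalizing l with
  | _ n ih =>
    match l with
    | [] => exact one_mem _
    | [f] => exact field_mem_fieldAlgebra f
    | f :: g :: l =>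
      rw [wick]
      exact sub_mem (mul_mem (field_mem_fieldAlgebra f) (ih _ (by simp [← hn]) (g :: l) rfl))
        (Subalgebra.smul_mem _ (ih l.length (by simp [← hn]) l rfl) _)

/-! ### Right field operators and the separating vacuum. -/

/-- The right field operator `x ↦ x ⊗ g + r*(ḡ) x`. -/
noncomputable def rightField (g : Cplx V) : Module.End ℂ (LinFock V) :=
  LinearMap.mulRight ℂ (TensorAlgebra.ι ℂ g) + contractR (Cplx.bil g)

lemma rightField_one (g : Cplx V) : rightField g (1 : LinFock V) = TensorAlgebra.ι ℂ g := by
  simp [rightField]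

/-- A right field acts behind the first letter. It can contract this letter only when nothing
follows it, which `vac x` detects. -/
lemma rightField_ι_mul (g f : Cplx V) (x : LinFock V) :
    rightField g (TensorAlgebra.ι ℂ f * x) =
      TensorAlgebra.ι ℂ f * rightField g x + (vac x * Cplx.bil g f) • (1 : LinFock V) := by
  simp [rightField, contractR_ι_mul, mul_add, mul_assoc]
  abel

/-- Left and right field operators commute. -/
lemma field_rightField (f g : Cplx V) (x : LinFock V) :
    field f (rightField g x) = rightField g (field f x) := by
  have h : field f ∘ₗ rightField g = rightField g ∘ₗ field f := by
    apply ext_word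
    intro l
    simp only [LinearMap.comp_apply]
    -- On the vacuum each field meets the letter created by the other, and both contractions give
    -- the same scalar. On a nonempty word the first letter isolates the action of the left field.
    match l with
    | [] =>
      have := field_ι_mul f g 1
      rw [mul_one] at this
      have h2 := rightField_ι_mul g f 1
      rw [mul_one, rightField_one, vac_one, one_mul] at h2
      rw [word_nil, rightField_one, field_one, this, h2, Cplx.bil_apply]
    | h :: l =>
      rw [word_cons, rightField_ι_mul, map_add, field_ι_mul, map_smul, field_one, field_ι_mul,
        map_add, rightField_ι_mul, vac_ι_mul, zero_mul, zero_smul, add_zero, rightField_ι_mul,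
        map_smul, mul_add, mul_smul_comm, mul_one]
      abel
  exact LinearMap.congr_fun h x

lemma rightField_commute {w : Module.End ℂ (LinFock V)} (hw : w ∈ fieldAlgebra V) (g : Cplx V)
    (x : LinFock V) : w (rightField g x) = rightField g (w x) := by
  induction hw using Algebra.adjoin_induction generalizing x with
  | mem w hw =>
    obtain ⟨f, rfl⟩ := hw
    exact field_rightField _ _ _
  | algebraMap r => simp
  | add a b _ _ ha hb => simp [ha, hb]
  | mul a b _ _ ha hb => simp [ha, hb]

/-- The vacuum is separating for the field algebra. -/
lemma eq_zero_of_apply_one {w : Module.End ℂ (LinFock V)} (hw : w ∈ fieldAlgebra V)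
    (h : w 1 = 0) : w = 0 := by
  apply ext_word
  intro l
  rw [LinearMap.zero_apply]
  induction hn : l.length using Nat.strong_induction_on generalizing l with
  | _ n ih =>
    rcases List.eq_nil_or_concat l with rfl | ⟨l, g, rfl⟩
    · exact h
    -- Up to a shorter word, each word is a right field applied to the word without its last letter.
    -- Since `w` commutes with right fields, its vanishing spreads from the vacuum to all words.
    · have h1 : word (l ++ [g]) = rightField g (word l) - contractR (Cplx.bil g) (word l) := by
        simp [rightField, word_append]
      simp only [List.concat_eq_append, List.length_append, List.length_singleton] at hn ⊢
      rw [h1, map_sub, rightField_commute hw, ih _ (by omega) l rfl, map_zero, zero_sub,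
        neg_eq_zero]
      rcases List.eq_nil_or_concat l with rfl | ⟨l, f, rfl⟩
      · simp
      · simp only [List.concat_eq_append, List.length_append, List.length_singleton] at hn ⊢
        rw [contractR_concat, map_smul, ih _ (by omega) l rfl, smul_zero]

lemma wick_unique {w : Module.End ℂ (LinFock V)} (hw : w ∈ fieldAlgebra V) {l : List (Cplx V)}
    (h : w 1 = word l) : w = wick l := by
  refine sub_eq_zero.1 (eq_zero_of_apply_one (sub_mem hw (wick_mem_fieldAlgebra l)) ?_)
  rw [LinearMap.sub_apply, h, wick_apply_one, sub_self]

lemma cyclicWick_mem_fieldAlgebra (l : List (Cplx V)) : cyclicWick l ∈ fieldAlgebra V := by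
  match l with
  | [] => exact one_mem _
  | [f] => exact field_mem_fieldAlgebra f
  | f :: g :: l =>
    exact sub_mem (wick_mem_fieldAlgebra _) (Subalgebra.smul_mem _ (wick_mem_fieldAlgebra _) _)

/-- The correction in the cyclic Wick product cancels the contraction term in the recursion for
`cyclize`. -/
lemma cyclize_cyclicWick {l : List (Cplx V)} (hl : l ≠ []) :
    cyclize (cyclicWick l 1) = circWord l := by
  match l with
  | [] => exact absurd rfl hl
  | [f] =>
    have := cyclize_single f
    rw [word_cons, word_nil, mul_one] at this
    rw [cyclicWick, field_one, this]
  | f :: g :: l =>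
    obtain ⟨m, h, e⟩ : ∃ m h, g :: l = m ++ [h] :=
      ⟨(g :: l).dropLast, (g :: l).getLast (by simp), (List.dropLast_append_getLast _).symm⟩
    rw [cyclicWick, LinearMap.sub_apply, LinearMap.smul_apply, wick_apply_one, wick_apply_one,
      map_sub, map_smul]
    simp only [e, cyclize_word, List.getLast_append_singleton, List.dropLast_concat]
    abel

lemma listInner_map_ofReal {ι : Type*} {e : ι → V} (he : Orthonormal ℝ e) [DecidableEq ι]
    (u v : List ι) :
    listInner (u.map fun i => Cplx.ofReal (e i)) (v.map fun i => Cplx.ofReal (e i)) =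
      if v = u then 1 else 0 := by
  induction u generalizing v with
  | nil => cases v <;> simp [listInner]
  | cons i u ih =>
    cases v with
    | nil => simp [listInner]
    | cons j v =>
      simp only [List.map_cons, listInner, ih, form_ofReal, (orthonormal_iff_ite.1 he) i j,
        List.cons.injEq]
      by_cases h1 : i = j <;> by_cases h2 : v = u <;> simp [h1, h2, eq_comm]

/-- Each rotation contributes a product of Kronecker deltas, so the sum over rotations counts
matches. -/
lemma cycInner_orthonormal {ι : Type*} {e : ι → V} (he : Orthonormal ℝ e) (u v : List ι)
    (hv : v ≠ []) :
    cycInner (circWord (u.map fun i => Cplx.ofReal (e i)))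
        (circWord (v.map fun i => Cplx.ofReal (e i))) =
      (Nat.card {k : Fin v.length // v.rotate k = u} : ℂ) := by
  classical
  rw [cycInner_circWord _ (by simpa using hv), List.length_map, Nat.card_eq_fintype_card,
    Fintype.card_subtype, Finset.sum_range]
  simp only [← List.map_rotate, listInner_map_ofReal he, Finset.sum_boole]

end FockWick

/-! ### Sums over the letters of a word -/

section SplitSum

variable {S A : Type*}

/-- The sum of `φ a g b` over all decompositions `u = a ++ g :: b`. -/
def splitSum [AddCommMonoid A] : (List S → S → List S → A) → List S → A
  | _, [] => 0
  | φ, g :: l => φ [] g l + splitSum (fun a h b => φ (g :: a) h b) l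

section Monoid
variable [AddCommMonoid A]

@[simp] lemma splitSum_nil (φ : List S → S → List S → A) : splitSum φ [] = 0 := rfl
lemma splitSum_cons (φ : List S → S → List S → A) (g : S) (l : List S) :
    splitSum φ (g :: l) = φ [] g l + splitSum (fun a h b => φ (g :: a) h b) l := rfl

lemma splitSum_concat (φ : List S → S → List S → A) (l : List S) (h : S) :
    splitSum φ (l ++ [h]) = splitSum (fun a g b => φ a g (b ++ [h])) l + φ l h [] := by
  induction l generalizing φ with
  | nil => simp [splitSum_cons]
  | cons g l ih => rw [List.cons_append, splitSum_cons, ih, splitSum_cons, add_assoc]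

lemma splitSum_congr {φ ψ : List S → S → List S → A} {l : List S}
    (h : ∀ a g b, a ++ g :: b = l → φ a g b = ψ a g b) : splitSum φ l = splitSum ψ l := by
  induction l generalizing φ ψ with
  | nil => rfl
  | cons g l ih =>
    rw [splitSum_cons, splitSum_cons, h [] g l rfl, ih fun a g' b e => h _ _ _ (by simp [e])]

lemma splitSum_add (φ ψ : List S → S → List S → A) (l : List S) :
    splitSum (fun a g b => φ a g b + ψ a g b) l = splitSum φ l + splitSum ψ l := by
  induction l generalizing φ ψ with
  | nil => simp
  | cons g l ih => simp only [splitSum_cons, ih]; exact add_add_add_comm _ _ _ _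

lemma splitSum_zero (l : List S) : splitSum (fun _ _ _ => (0 : A)) l = 0 := by
  induction l with
  | nil => rfl
  | cons g l ih => rw [splitSum_cons, ih, add_zero]

lemma splitSum_reverse (φ : List S → S → List S → A) (l : List S) :
    splitSum φ l.reverse = splitSum (fun a g b => φ b.reverse g a.reverse) l := by
  induction l generalizing φ with
  | nil => rfl
  | cons g l ih =>
    rw [List.reverse_cons, splitSum_concat, ih, splitSum_cons, add_comm]
    simp

/-- A splitting `a ++ g :: b` is the same datum as the rotation that brings the letter `g` to the
front. -/
lemma splitSum_eq_sum_rotate (F : List S → A) (l : List S) :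
    splitSum (fun a g b => F (g :: (b ++ a))) l =
      ∑ k ∈ Finset.range l.length, F (l.rotate k) := by
  -- The accumulator `m` stores the letters already passed, which makes induction on the remaining
  -- list possible.
  have key : ∀ (m l : List S), splitSum (fun a g b => F (g :: (b ++ (m ++ a)))) l =
      ∑ k ∈ Finset.range l.length, F (l.drop k ++ (m ++ l.take k)) := by
    intro m l
    induction l generalizing m with
    | nil => simp
    | cons g l ih =>
      rw [splitSum_cons, List.length_cons, Finset.sum_range_succ', add_comm]
      have := ih (m ++ [g])
      simp only [List.append_assoc, List.singleton_append] at this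
      rw [this]
      simp
  have := key [] l
  simp only [List.nil_append] at this
  rw [this]
  refine Finset.sum_congr rfl fun k hk => ?_
  rw [List.rotate_eq_drop_append_take (Finset.mem_range.1 hk).le]

lemma map_splitSum {A' F : Type*} [AddCommMonoid A'] [FunLike F A A'] [AddMonoidHomClass F A A']
    (T : F) (φ : List S → S → List S → A) (l : List S) :
    T (splitSum φ l) = splitSum (fun a g b => T (φ a g b)) l := by
  induction l generalizing φ with
  | nil => simp
  | cons g l ih => simp only [splitSum_cons, map_add, ih]

lemma sum_splitSum {ι : Type*} (s : Finset ι) (φ : ι → List S → S → List S → A) (l : List S) :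
    ∑ i ∈ s, splitSum (φ i) l = splitSum (fun a g b => ∑ i ∈ s, φ i a g b) l := by
  induction l generalizing φ with
  | nil => simp
  | cons g l ih => simp only [splitSum_cons, Finset.sum_add_distrib, ih]

end Monoid

lemma splitSum_sub [AddCommGroup A] (φ ψ : List S → S → List S → A) (l : List S) :
    splitSum (fun a g b => φ a g b - ψ a g b) l = splitSum φ l - splitSum ψ l := by
  induction l generalizing φ ψ with
  | nil => simp
  | cons g l ih => simp only [splitSum_cons, ih]; abel

section Ring
variable [NonUnitalNonAssocSemiring A]

lemma mul_splitSum (c : A) (φ : List S → S → List S → A) (l : List S) :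
    c * splitSum φ l = splitSum (fun a g b => c * φ a g b) l :=
  map_splitSum (AddMonoidHom.mulLeft c) φ l

lemma splitSum_mul (c : A) (φ : List S → S → List S → A) (l : List S) :
    splitSum φ l * c = splitSum (fun a g b => φ a g b * c) l :=
  map_splitSum (AddMonoidHom.mulRight c) φ l

end Ring

lemma smul_splitSum {𝕜 : Type*} [AddCommMonoid A] [DistribSMul 𝕜 A] (c : 𝕜)
    (φ : List S → S → List S → A) (l : List S) :
    c • splitSum φ l = splitSum (fun a g b => c • φ a g b) l :=
  map_splitSum (DistribSMul.toAddMonoidHom A c) φ l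

end SplitSum

/-! ### Derivatives of words -/

section Derivative

variable {V : Type*} [NormedAddCommGroup V] [InnerProductSpace ℝ V]
variable {B : Type*} [Ring B] [Algebra ℂ B] (ξ : V → B)

/-- The derivative of a product of letters. -/
lemma derivation_list_prod {M : Type*} [Ring M] {S : Type*} (ζ : S → M) (δ : M →+ M)
    (hδ : ∀ x y, δ (x * y) = δ x * y + x * δ y) (u : List S) :
    δ (u.map ζ).prod =
      splitSum (fun a g b => (a.map ζ).prod * δ (ζ g) * (b.map ζ).prod) u := by
  have h1 : δ 1 = 0 := by
    have := hδ 1 1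
    simpa using this
  induction u with
  | nil => simp [h1]
  | cons g l ih =>
    rw [List.map_cons, List.prod_cons, hδ, ih, splitSum_cons, mul_splitSum]
    simp [mul_assoc]

/-- The derivative of a Wick word. -/
lemma derivation_wickIn (δ : B →ₗ[ℂ] B) (hδ : ∀ x y, δ (x * y) = δ x * y + x * δ y) (f₀ : V)
    (P : B) (c : ℂ) (hξ : ∀ g, δ (ξ g) = (c * (inner ℝ f₀ g : ℝ)) • P) (u : List V) :
    δ (wickIn ξ u) =
      splitSum (fun a g b => (c * (inner ℝ f₀ g : ℝ)) • (wickIn ξ a * P * wickIn ξ b)) u := by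
  have h1 : δ 1 = 0 := by
    have := hδ 1 1
    simpa using this
  induction hn : u.length using Nat.strong_induction_on generalizing u with
  | _ n ih =>
    match u with
    | [] => simp [h1]
    | [f] => simp [splitSum_cons, hξ]
    | f :: g :: l =>
      have e1 := ih _ (by simp [← hn]) (g :: l) rfl
      have e2 := ih l.length (by simp [← hn]) l rfl
      rw [wickIn_cons_cons, map_sub, hδ, map_smul, e1, e2, hξ, splitSum_cons, splitSum_cons,
        splitSum_cons, mul_add, mul_splitSum, smul_splitSum]
      -- When a letter beyond the first two is differentiated, the left part begins with `f :: g`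
      -- and obeys the Wick recursion. The splittings at `f` and at `g` are left as boundary terms.
      have e3 : (fun a h b => (c * (inner ℝ f₀ h : ℝ)) •
          (wickIn ξ (f :: g :: a) * P * wickIn ξ b)) =
          fun a h b => ξ f * ((c * (inner ℝ f₀ h : ℝ)) • (wickIn ξ (g :: a) * P * wickIn ξ b)) -
            ((inner ℝ f g : ℝ) : ℂ) •
              ((c * (inner ℝ f₀ h : ℝ)) • (wickIn ξ a * P * wickIn ξ b)) := by
        funext a h b
        rw [wickIn_cons_cons]
        simp only [sub_mul, smul_sub, mul_smul_comm, smul_mul_assoc, mul_assoc]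
        rw [smul_comm ((inner ℝ f g : ℝ) : ℂ)]
      rw [e3, splitSum_sub]
      simp only [wickIn_nil, one_mul, wickIn_singleton, smul_mul_assoc, mul_smul_comm, mul_assoc]
      abel

/-- The cyclic derivative of a cyclic Wick word. -/
lemma cyclic_derivative_cyclicIn {M : Type*} [AddCommGroup M] [Module ℂ M] (T : B →ₗ[ℂ] M)
    (s : V → ℂ) (h₁ h₂ : V) (l : List V) :
    splitSum (fun a g b => s g • T (wickIn ξ b * wickIn ξ a)) (h₁ :: (l ++ [h₂])) -
      ((inner ℝ h₁ h₂ : ℝ) : ℂ) • splitSum (fun a g b => s g • T (wickIn ξ b * wickIn ξ a)) l =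
    splitSum (fun a g b => s g • T (wickIn ξ (b ++ a))) (h₁ :: (l ++ [h₂])) := by
  rw [splitSum_cons, splitSum_concat, splitSum_cons, splitSum_concat, smul_splitSum]
  -- At an inner letter the two ends `h₂` and `h₁` meet. Their contraction is the derivative of the
  -- subtracted term of the cyclic word, so after cancellation only a single Wick word is left.
  have e : (fun a g b => s g • T (wickIn ξ (b ++ [h₂]) * wickIn ξ (h₁ :: a))) =
      fun a g b => s g • T (wickIn ξ ((b ++ [h₂]) ++ h₁ :: a)) +
        ((inner ℝ h₁ h₂ : ℝ) : ℂ) • s g • T (wickIn ξ b * wickIn ξ a) := by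
    funext a g b
    rw [wickIn_concat_mul_wickIn_cons, map_add, map_smul, smul_add, real_inner_comm,
      List.append_assoc, smul_comm]
    rfl
  rw [e, splitSum_add]
  simp only [wickIn_nil, mul_one, one_mul, List.append_nil, List.nil_append]
  abel

end Derivative

/-! ### Gaussian integration by parts -/

section Moments

variable {Ω : Type*} [MeasurableSpace Ω] {P : Measure Ω}

/-- All moments of a complex random variable exist. -/
def HasMoments (P : Measure Ω) (A : Ω → ℂ) : Prop := ∀ p : ENNReal, p ≠ ⊤ → MemLp A p P

lemma HasMoments.add {A B : Ω → ℂ} (hA : HasMoments P A) (hB : HasMoments P B) :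
    HasMoments P fun a => A a + B a := fun p hp => (hA p hp).add (hB p hp)

/-- Hölder's inequality with both exponents `2 * p`. Having all finite moments at hand makes the
class closed under products. -/
lemma HasMoments.mul {A B : Ω → ℂ} (hA : HasMoments P A) (hB : HasMoments P B) :
    HasMoments P fun a => A a * B a := by
  intro p hp
  have h2 : 2 * p ≠ ⊤ := ENNReal.mul_ne_top (by simp) hp
  have : ENNReal.HolderTriple (2 * p) (2 * p) p := by
    constructor
    rw [← two_mul, ENNReal.mul_inv (by simp) (by simp), ← mul_assoc,
      ENNReal.mul_inv_cancel (by simp) (by simp), one_mul]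
  exact (hB (2 * p) h2).mul' (hA (2 * p) h2)

lemma hasMoments_const [IsFiniteMeasure P] (c : ℂ) : HasMoments P fun _ => c :=
  fun _ _ => memLp_const c

lemma HasMoments.integrable {A : Ω → ℂ} (hA : HasMoments P A) : Integrable A P :=
  memLp_one_iff_integrable.1 (hA 1 (by simp))

lemma hasMoments_aeval [IsFiniteMeasure P] {T : Type*} {Z : T → Ω → ℂ}
    (hZ : ∀ t, HasMoments P (Z t)) (p : MvPolynomial T ℂ) :
    HasMoments P fun a => MvPolynomial.aeval (fun t => Z t a) p := by
  induction p using MvPolynomial.induction_on with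
  | C c => simpa using hasMoments_const c
  | add p q hp hq => simpa using hp.add hq
  | mul_X p t hp => simpa using hp.mul (hZ t)

/-- The expectation of polynomials in a family of random variables. -/
noncomputable def polyExp [IsFiniteMeasure P] {T : Type*} (Z : T → Ω → ℂ)
    (hZ : ∀ t, HasMoments P (Z t)) : MvPolynomial T ℂ →ₗ[ℂ] ℂ where
  toFun p := ∫ a, MvPolynomial.aeval (fun t => Z t a) p ∂P
  map_add' p q := by
    simp only [map_add]
    exact integral_add (hasMoments_aeval hZ p).integrable (hasMoments_aeval hZ q).integrable
  map_smul' c p := by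
    simp only [map_smul, RingHom.id_apply]
    exact integral_smul c _

lemma polyExp_apply [IsFiniteMeasure P] {T : Type*} (Z : T → Ω → ℂ)
    (hZ : ∀ t, HasMoments P (Z t)) (p : MvPolynomial T ℂ) :
    polyExp Z hZ p = ∫ a, MvPolynomial.aeval (fun t => Z t a) p ∂P := rfl

lemma hasMoments_ofReal_of_hasGaussianLaw {Y : Ω → ℝ} (hY : HasGaussianLaw Y P) :
    HasMoments P fun a => (Y a : ℂ) := fun _ hp => (hY.memLp hp).ofReal

/-! ### Stein's lemma in one variable. -/

lemma integrable_pow_gaussianReal (v : NNReal) (n : ℕ) :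
    Integrable (fun x : ℝ => x ^ n) (gaussianReal 0 v) := by
  rcases Nat.eq_zero_or_pos n with rfl | hn
  · simp
  have h := (memLp_id_gaussianReal' (μ := 0) (v := v) n (by simp)).integrable_norm_pow
    (by omega)
  refine h.mono' (by fun_prop) (ae_of_all _ fun x => ?_)
  simp

lemma integrable_pow_mul_gaussianPDFReal {v : NNReal} (hv : v ≠ 0) (n : ℕ) :
    Integrable (fun x : ℝ => x ^ n * gaussianPDFReal 0 v x) := by
  have h := integrable_pow_gaussianReal v n
  rw [gaussianReal_of_var_ne_zero _ hv, integrable_withDensity_iff_integrable_smul'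
    (measurable_gaussianPDF _ _) (ae_of_all _ fun _ => gaussianPDF_lt_top)] at h
  simpa [toReal_gaussianPDF, mul_comm] using h

lemma hasDerivAt_gaussianPDFReal {v : NNReal} (hv : v ≠ 0) (x : ℝ) :
    HasDerivAt (gaussianPDFReal 0 v) (-(x / v) * gaussianPDFReal 0 v x) x := by
  have hv' : (v : ℝ) ≠ 0 := by exact_mod_cast hv
  have h1 : HasDerivAt (fun x : ℝ => -(x - 0) ^ 2 / (2 * v)) (-(x / v)) x := by
    have := (((hasDerivAt_id x).sub_const 0).pow 2).neg.div_const (2 * (v : ℝ))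
    refine this.congr_deriv ?_
    simp only [id, Nat.cast_ofNat, sub_zero]
    field_simp
    norm_num
  have h2 := (h1.exp).const_mul ((√(2 * Real.pi * v))⁻¹)
  have h3 : gaussianPDFReal 0 v =
      fun x => (√(2 * Real.pi * v))⁻¹ * Real.exp (-(x - 0) ^ 2 / (2 * v)) := by
    funext x; rw [gaussianPDFReal]
  rw [h3]
  exact h2.congr_deriv (by ring)

/-- Stein's lemma for monomials. -/
lemma integral_pow_succ_gaussianReal (v : NNReal) (n : ℕ) :
    ∫ x, x ^ (n + 1) ∂(gaussianReal 0 v) = v * (n * ∫ x, x ^ (n - 1) ∂(gaussianReal 0 v)) := by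
  -- A vanishing variance gives a point mass without density; otherwise one integrates by parts
  -- against the density. For `n = 0` the truncated exponent `n - 1` is harmless because of the
  -- factor `n`.
  rcases eq_or_ne v 0 with rfl | hv
  · simp [gaussianReal_zero_var]
  have hv' : (v : ℝ) ≠ 0 := by exact_mod_cast hv
  have h := integral_mul_deriv_eq_deriv_mul_of_integrable
    (u := fun x : ℝ => x ^ n) (u' := fun x => n * x ^ (n - 1)) (v := gaussianPDFReal 0 v)
    (v' := fun x => -(x / v) * gaussianPDFReal 0 v x)
    (fun x _ => hasDerivAt_pow n x) (fun x _ => hasDerivAt_gaussianPDFReal hv x)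
    (by
      refine ((integrable_pow_mul_gaussianPDFReal hv (n + 1)).const_mul (-(1 / v : ℝ))).congr
        (ae_of_all _ fun x => ?_)
      simp only [Pi.mul_apply]; ring)
    (by
      refine ((integrable_pow_mul_gaussianPDFReal hv (n - 1)).const_mul (n : ℝ)).congr
        (ae_of_all _ fun x => ?_)
      simp only [Pi.mul_apply]; ring)
    (integrable_pow_mul_gaussianPDFReal hv n)
  rw [integral_gaussianReal_eq_integral_smul hv, integral_gaussianReal_eq_integral_smul hv]
  have e1 : ∫ x : ℝ, x ^ n * (-(x / v) * gaussianPDFReal 0 v x) =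
      -(1 / v : ℝ) * ∫ x, gaussianPDFReal 0 v x • x ^ (n + 1) := by
    rw [← integral_const_mul]
    congr 1; funext x; simp only [smul_eq_mul]; ring
  have e2 : ∫ x : ℝ, n * x ^ (n - 1) * gaussianPDFReal 0 v x =
      n * ∫ x, gaussianPDFReal 0 v x • x ^ (n - 1) := by
    rw [← integral_const_mul]
    congr 1; funext x; simp only [smul_eq_mul]; ring
  rw [e1, e2] at h
  field_simp at h
  linarith

lemma measurable_aeval_ofReal {T : Type*} (r : MvPolynomial T ℂ) :
    Measurable fun x : T → ℝ => MvPolynomial.aeval (fun t => (x t : ℂ)) r := by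
  induction r using MvPolynomial.induction_on with
  | C c => simp
  | add p q hp hq =>
    simp only [map_add]
    exact hp.add hq
  | mul_X p t hp =>
    simp only [map_mul, MvPolynomial.aeval_X]
    exact hp.mul (Complex.measurable_ofReal.comp (measurable_pi_apply t))

variable {T : Type*} {G : T → Ω → ℝ}

/-- Gaussian integration by parts for a polynomial in a single variable whose coefficients are
independent of it. -/
lemma integral_mul_eval₂_of_indepFun [IsProbabilityMeasure P] {Y : Ω → ℝ}
    (hY : HasGaussianLaw Y P)
    (hY0 : ∫ a, Y a ∂P = 0) {R : T → Ω → ℝ} (hR : ∀ t, HasGaussianLaw (R t) P)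
    (hYR : IndepFun Y (fun a t => R t a) P) (q : Polynomial (MvPolynomial T ℂ)) :
    ∫ a, (Y a : ℂ) *
        q.eval₂ (MvPolynomial.aeval fun t => (R t a : ℂ) : MvPolynomial T ℂ →ₐ[ℂ] ℂ).toRingHom (Y a) ∂P =
      (∫ a, Y a ^ 2 ∂P : ℝ) * ∫ a, q.derivative.eval₂
        (MvPolynomial.aeval fun t => (R t a : ℂ) : MvPolynomial T ℂ →ₐ[ℂ] ℂ).toRingHom (Y a) ∂P := by
  have hmR := hasMoments_aeval (P := P) (Z := fun t a => (R t a : ℂ))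
    fun t => hasMoments_ofReal_of_hasGaussianLaw (hR t)
  have hmY := hasMoments_ofReal_of_hasGaussianLaw hY
  have hpow : ∀ n : ℕ, HasMoments P fun a => (Y a : ℂ) ^ n := by
    intro n
    induction n with
    | zero => simpa using hasMoments_const 1
    | succ n ih => simpa only [pow_succ] using ih.mul hmY
  have hm : ∀ q : Polynomial (MvPolynomial T ℂ), HasMoments P fun a => q.eval₂
      (MvPolynomial.aeval fun t => (R t a : ℂ) : MvPolynomial T ℂ →ₐ[ℂ] ℂ).toRingHom (Y a) := by
    intro q
    induction q using Polynomial.induction_on' with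
    | add p q hp hq => simpa only [Polynomial.eval₂_add] using hp.add hq
    | monomial n r =>
      simp only [Polynomial.eval₂_monomial]
      exact (hmR r).mul (hpow n)
  have hvar : (Var[Y; P].toNNReal : ℝ) = ∫ a, Y a ^ 2 ∂P := by
    rw [Real.coe_toNNReal _ (variance_nonneg _ _), variance_of_integral_eq_zero hY.aemeasurable hY0]
  have hmom : ∀ n : ℕ, ∫ a, Y a ^ n ∂P = ∫ x, x ^ n ∂(gaussianReal 0 Var[Y; P].toNNReal) := by
    intro n
    have h1 := hY.map_eq_gaussianReal
    rw [hY0] at h1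
    rw [← h1, integral_map hY.aemeasurable (by fun_prop)]
  -- Independence separates the power of `Y` from its coefficient, which leaves Stein's lemma for a
  -- single power.
  have hind : ∀ (n : ℕ) (r : MvPolynomial T ℂ),
      ∫ a, (Y a : ℂ) ^ n * MvPolynomial.aeval (fun t => (R t a : ℂ)) r ∂P =
        ((∫ a, Y a ^ n ∂P : ℝ) : ℂ) * ∫ a, MvPolynomial.aeval (fun t => (R t a : ℂ)) r ∂P := by
    intro n r
    have h1 := hYR.comp (φ := fun y : ℝ => (y : ℂ) ^ n)
      (ψ := fun x : T → ℝ => MvPolynomial.aeval (fun t => (x t : ℂ)) r)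
      (by fun_prop) (measurable_aeval_ofReal r)
    have h2 := h1.integral_fun_mul_eq_mul_integral (hpow n).integrable.aestronglyMeasurable
      (hmR r).integrable.aestronglyMeasurable
    rw [← integral_complex_ofReal]
    simpa using h2
  induction q using Polynomial.induction_on' with
  | add p q hp hq =>
    simp only [Polynomial.eval₂_add, mul_add, Polynomial.derivative_add]
    rw [integral_add (hmY.mul (hm p)).integrable (hmY.mul (hm q)).integrable,
      integral_add (hm _).integrable (hm _).integrable, hp, hq, mul_add]
  | monomial n r =>
    rw [Polynomial.derivative_monomial]
    simp only [Polynomial.eval₂_monomial, map_mul, map_natCast, AlgHom.toRingHom_eq_coe,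
      RingHom.coe_coe]
    have e1 : ∀ a, (Y a : ℂ) * (MvPolynomial.aeval (fun t => (R t a : ℂ)) r * (Y a : ℂ) ^ n) =
        (Y a : ℂ) ^ (n + 1) * MvPolynomial.aeval (fun t => (R t a : ℂ)) r := fun a => by ring
    have e2 : ∀ a, MvPolynomial.aeval (fun t => (R t a : ℂ)) r * (n : ℂ) * (Y a : ℂ) ^ (n - 1) =
        (n : ℂ) * ((Y a : ℂ) ^ (n - 1) * MvPolynomial.aeval (fun t => (R t a : ℂ)) r) :=
      fun a => by ring
    simp only [e1, e2]
    rw [integral_const_mul, hind, hind, ← hvar, hmom, hmom, integral_pow_succ_gaussianReal]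
    push_cast
    ring

/-! ### Integration by parts in Gaussian processes. -/

/-- The derivation on polynomials with `X_s ↦ c_s`. -/
noncomputable def constDeriv (c : T → ℂ) : Derivation ℂ (MvPolynomial T ℂ) (MvPolynomial T ℂ) :=
  MvPolynomial.mkDerivation ℂ fun s => MvPolynomial.C (c s)

@[simp] lemma constDeriv_X (c : T → ℂ) (s : T) :
    constDeriv c (MvPolynomial.X s) = MvPolynomial.C (c s) :=
  MvPolynomial.mkDerivation_X _ _ _

@[simp] lemma constDeriv_C (c : T → ℂ) (x : ℂ) : constDeriv c (MvPolynomial.C x) = 0 :=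
  MvPolynomial.derivation_C _ _

/-- The substitution `X_t ↦ c_t X + X_t`. -/
noncomputable def affineHom (c : T → ℝ) : MvPolynomial T ℂ →ₐ[ℂ] Polynomial (MvPolynomial T ℂ) :=
  MvPolynomial.aeval fun t =>
    Polynomial.C (MvPolynomial.C (c t : ℂ)) * Polynomial.X + Polynomial.C (MvPolynomial.X t)

lemma affineHom_X (c : T → ℝ) (t : T) : affineHom c (MvPolynomial.X t) =
    Polynomial.C (MvPolynomial.C (c t : ℂ)) * Polynomial.X + Polynomial.C (MvPolynomial.X t) := by
  simp [affineHom]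

lemma affineHom_C (c : T → ℝ) (x : ℂ) :
    affineHom c (MvPolynomial.C x) = Polynomial.C (MvPolynomial.C x) := by
  rw [← MvPolynomial.algebraMap_eq, AlgHom.commutes]; rfl

lemma eval₂_affineHom (c : T → ℝ) (x : T → ℂ) (y : ℂ) (p : MvPolynomial T ℂ) :
    (affineHom c p).eval₂
      (MvPolynomial.aeval x : MvPolynomial T ℂ →ₐ[ℂ] ℂ).toRingHom y =
        MvPolynomial.aeval (fun t => c t * y + x t) p := by
  induction p using MvPolynomial.induction_on with
  | C x => rw [affineHom_C]; simp
  | add p q hp hq => rw [map_add, map_add, Polynomial.eval₂_add, hp, hq]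
  | mul_X p t hp =>
    rw [map_mul, map_mul, Polynomial.eval₂_mul, hp, affineHom_X]
    simp

/-- The chain rule: each variable depends on the new one with slope `c t`. In the application `v` is
the variance of `G t₀`, so `v * c t` is its covariance with `G t`. -/
lemma C_mul_derivative_affineHom (c : T → ℝ) (v : ℂ) (p : MvPolynomial T ℂ) :
    Polynomial.C (MvPolynomial.C v) * (affineHom c p).derivative =
      affineHom c (constDeriv (fun t => v * (c t : ℂ)) p) := by
  induction p using MvPolynomial.induction_on with
  | C x => rw [affineHom_C, constDeriv_C, Polynomial.derivative_C, mul_zero, map_zero]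
  | add p q hp hq =>
    rw [map_add, Polynomial.derivative_add, map_add, map_add, mul_add, hp, hq]
  | mul_X p t hp =>
    rw [map_mul, Polynomial.derivative_mul, mul_add, ← mul_assoc, hp,
      Derivation.leibniz, constDeriv_X, map_add, smul_eq_mul, smul_eq_mul]
    simp only [map_mul, affineHom_C, affineHom_X, Polynomial.derivative_add, Polynomial.derivative_mul,
      Polynomial.derivative_C, Polynomial.derivative_X, zero_mul, zero_add, mul_one, add_zero]
    ring

/-- Gaussian integration by parts for polynomials in a real Gaussian process. -/
lemma integral_mul_aeval_of_isGaussianProcess (hG : IsGaussianProcess G P)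
    (h0 : ∀ t, ∫ a, G t a ∂P = 0) (t₀ : T) (p : MvPolynomial T ℂ) :
    ∫ a, (G t₀ a : ℂ) * MvPolynomial.aeval (fun t => (G t a : ℂ)) p ∂P =
      ∫ a, MvPolynomial.aeval (fun t => (G t a : ℂ))
        (constDeriv (fun t => ((∫ a, G t₀ a * G t a ∂P : ℝ) : ℂ)) p) ∂P := by
  classical
  have := hG.isProbabilityMeasure
  have hL : ∀ t, MemLp (G t) 2 P := fun t => (hG.hasGaussianLaw_eval t).memLp_two
  have hint : ∀ t s, Integrable (fun a => G t a * G s a) P := fun t s =>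
    (hL t).integrable_mul (hL s)
  set v : ℝ := ∫ a, G t₀ a ^ 2 ∂P with hv
  rcases eq_or_ne v 0 with hv0 | hv0
  · have hz : G t₀ =ᵐ[P] 0 := by
      have h1 := (integral_eq_zero_iff_of_nonneg (f := fun a => G t₀ a ^ 2)
        (fun a => sq_nonneg _) (hL t₀).integrable_sq).1 hv0
      filter_upwards [h1] with a ha
      simpa using ha
    have h1 : ∀ t, ∫ a, G t₀ a * G t a ∂P = 0 := fun t =>
      integral_eq_zero_of_ae (by filter_upwards [hz] with a ha; simp [ha])
    have h2 : constDeriv (fun t => ((∫ a, G t₀ a * G t a ∂P : ℝ) : ℂ)) p = 0 := by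
      have : constDeriv (fun t => ((∫ a, G t₀ a * G t a ∂P : ℝ) : ℂ)) = 0 := by
        apply MvPolynomial.derivation_ext
        intro i
        simp [h1]
      rw [this]; rfl
    rw [h2]
    simp only [map_zero, integral_zero]
    exact integral_eq_zero_of_ae (by filter_upwards [hz] with a ha; simp [ha])
  -- Linear regression on `G t₀`: the residuals `R t` are uncorrelated with `G t₀`, hence
  -- independent of it by joint Gaussianity.
  · let c : T → ℝ := fun t => (∫ a, G t₀ a * G t a ∂P) / v
    let R : T → Ω → ℝ := fun t a => G t a - c t * G t₀ a
    have hjoint : IsGaussianProcess (Sum.elim (fun (_ : Unit) => G t₀) R) P := by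
      refine hG.of_isGaussianProcess ?_
      rintro (_ | t)
      · exact ⟨{t₀},
          { toFun x := x ⟨t₀, by simp⟩
            map_add' := by simp
            map_smul' := by simp },
          fun a => rfl⟩
      · exact ⟨{t, t₀},
          { toFun x := x ⟨t, by simp⟩ - c t * x ⟨t₀, by simp⟩
            map_add' x y := by simp; ring
            map_smul' m x := by simp; ring },
          fun a => rfl⟩
    have hR : ∀ t, HasGaussianLaw (R t) P := fun t => hjoint.hasGaussianLaw_eval (Sum.inr t)
    have hR0 : ∀ t, ∫ a, R t a ∂P = 0 := by
      intro t
      rw [integral_sub ((hL t).integrable (by norm_num))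
        (((hL t₀).integrable (by norm_num)).const_mul _), integral_const_mul, h0, h0]
      simp
    have hind : IndepFun (G t₀) (fun a t => R t a) P := by
      have h1 := hjoint.indepFun_of_covariance_eq_zero
        (fun _ => hG.aemeasurable t₀) (fun t => (hR t).aemeasurable) (by
          intro _ t
          rw [covariance_eq_sub (hL t₀) (hR t).memLp_two, h0]
          have e : ∀ a, (G t₀ * R t) a = G t₀ a * G t a - c t * G t₀ a ^ 2 := by
            intro a; simp only [Pi.mul_apply, R]; ring
          simp only [e]
          rw [integral_sub (hint _ _) ((hL t₀).integrable_sq.const_mul _), integral_const_mul,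
            ← hv]
          simp [c, div_mul_cancel₀ _ hv0])
      exact h1.comp (φ := fun x : Unit → ℝ => x ()) (ψ := id) (measurable_pi_apply _)
        measurable_id
    have key := integral_mul_eval₂_of_indepFun (hG.hasGaussianLaw_eval t₀) (h0 t₀) hR hind
      (affineHom c p)
    have hθ : ∀ (a : Ω) (p : MvPolynomial T ℂ), (affineHom c p).eval₂
        (MvPolynomial.aeval fun t => (R t a : ℂ) : MvPolynomial T ℂ →ₐ[ℂ] ℂ).toRingHom
          (G t₀ a : ℂ) = MvPolynomial.aeval (fun t => (G t a : ℂ)) p := by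
      intro a p
      rw [eval₂_affineHom]
      congr 2
      funext t
      simp [R]
    simp only [hθ] at key
    rw [key, ← hv, ← integral_const_mul]
    congr 1
    funext a
    have e : (fun t => ((∫ a, G t₀ a * G t a ∂P : ℝ) : ℂ)) = fun t => (v : ℂ) * (c t : ℂ) := by
      funext t
      rw [← Complex.ofReal_mul, mul_div_cancel₀ _ hv0]
    rw [← hθ a (constDeriv _ p), e, ← C_mul_derivative_affineHom, Polynomial.eval₂_mul,
      Polynomial.eval₂_C]
    simp

/-- Gaussian integration by parts for polynomials in a complex Gaussian process. -/
lemma polyExp_X_mul [IsProbabilityMeasure P] {Z : T → Ω → ℂ} (hZ : IsGaussianProcess Z P)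
    (h0 : ∀ t, ∫ a, Z t a ∂P = 0) (hm : ∀ t, HasMoments P (Z t)) (t₀ : T)
    (p : MvPolynomial T ℂ) :
    polyExp Z hm (MvPolynomial.X t₀ * p) =
      polyExp Z hm (constDeriv (fun t => ∫ a, Z t₀ a * Z t a ∂P) p) := by
  -- Real and imaginary parts form a real Gaussian process. The covariance involved has no
  -- conjugation, so it extends bilinearly through the substitution `ψ` below.
  let G : T × Bool → Ω → ℝ := fun s a => if s.2 then (Z s.1 a).im else (Z s.1 a).re
  have hG : IsGaussianProcess G P := by
    have h1 := (hZ.comp_right (Prod.fst : T × Bool → T)).comp_left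
      fun s => if s.2 then Complex.imCLM else Complex.reCLM
    have h2 : G = fun s a => (if s.2 then Complex.imCLM else Complex.reCLM) (Z s.1 a) := by
      funext s a
      rcases s with ⟨s, _ | _⟩ <;> simp [G]
    rw [h2]
    exact h1
  have hZi : ∀ t, Integrable (Z t) P := fun t => (hm t).integrable
  have hG0 : ∀ s, ∫ a, G s a ∂P = 0 := by
    rintro ⟨t, _ | _⟩
    · have := integral_re (𝕜 := ℂ) (hZi t)
      rw [h0] at this
      simpa [G] using this
    · have := integral_im (𝕜 := ℂ) (hZi t)
      rw [h0] at this
      simpa [G] using this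
  have hGm : ∀ s, HasMoments P fun a => (G s a : ℂ) := fun s =>
    hasMoments_ofReal_of_hasGaussianLaw (hG.hasGaussianLaw_eval s)
  have hZG : ∀ t a, Z t a = (G (t, false) a : ℂ) + Complex.I * (G (t, true) a : ℂ) := by
    intro t a
    simp only [G, Bool.false_eq_true, if_false, if_true]
    rw [mul_comm, Complex.re_add_im]
  let ψ : MvPolynomial T ℂ →ₐ[ℂ] MvPolynomial (T × Bool) ℂ := MvPolynomial.aeval fun t =>
    MvPolynomial.X (t, false) + MvPolynomial.C Complex.I * MvPolynomial.X (t, true)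
  have hψX : ∀ t, ψ (MvPolynomial.X t) =
      MvPolynomial.X (t, false) + MvPolynomial.C Complex.I * MvPolynomial.X (t, true) := by
    intro t; simp [ψ]
  have hψC : ∀ x, ψ (MvPolynomial.C x) = MvPolynomial.C x := by
    intro x; rw [← MvPolynomial.algebraMap_eq, AlgHom.commutes]; rfl
  have hψ : ∀ (q : MvPolynomial T ℂ), polyExp Z hm q =
      polyExp (fun s a => (G s a : ℂ)) hGm (ψ q) := by
    intro q
    rw [polyExp_apply, polyExp_apply]
    congr 1
    funext a
    have : (MvPolynomial.aeval fun t => Z t a : MvPolynomial T ℂ →ₐ[ℂ] ℂ) =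
        (MvPolynomial.aeval fun s => (G s a : ℂ)).comp ψ := by
      apply MvPolynomial.algHom_ext
      intro t
      rw [AlgHom.comp_apply, hψX]
      simp [hZG]
    rw [this]; rfl
  let γ : T × Bool → T × Bool → ℂ := fun s r => ((∫ a, G s a * G r a ∂P : ℝ) : ℂ)
  have hGI : ∀ (s : T × Bool) (q : MvPolynomial (T × Bool) ℂ),
      polyExp (fun s a => (G s a : ℂ)) hGm (MvPolynomial.X s * q) =
        polyExp (fun s a => (G s a : ℂ)) hGm (constDeriv (γ s) q) := by
    intro s q
    rw [polyExp_apply, polyExp_apply, ← integral_mul_aeval_of_isGaussianProcess hG hG0]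
    simp
  have hcov : ∀ t, ∫ a, Z t₀ a * Z t a ∂P =
      (γ (t₀, false) (t, false) + Complex.I * γ (t₀, false) (t, true)) +
        Complex.I * (γ (t₀, true) (t, false) + Complex.I * γ (t₀, true) (t, true)) := by
    intro t
    have h1 : ∀ s r, γ s r = polyExp (fun s a => (G s a : ℂ)) hGm
        (MvPolynomial.X s * MvPolynomial.X r) := by
      intro s r
      rw [polyExp_apply]
      simp only [γ, map_mul, MvPolynomial.aeval_X, ← Complex.ofReal_mul]
      rw [integral_complex_ofReal]
    have h2 : ∫ a, Z t₀ a * Z t a ∂P =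
        polyExp Z hm (MvPolynomial.X t₀ * MvPolynomial.X t) := by
      rw [polyExp_apply]; simp
    rw [h2, hψ, map_mul, hψX, hψX]
    simp only [h1]
    simp only [← smul_eq_mul (a := Complex.I), ← map_smul, ← map_add]
    congr 1
    simp only [MvPolynomial.smul_eq_C_mul]
    ring
  -- Both sides obey the Leibniz rule along `ψ`, so they need only be compared on variables, where
  -- `hcov` is the required identity.
  have hD : ∀ q : MvPolynomial T ℂ,
      constDeriv (γ (t₀, false)) (ψ q) + MvPolynomial.C Complex.I * constDeriv (γ (t₀, true)) (ψ q) =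
        ψ (constDeriv (fun t => ∫ a, Z t₀ a * Z t a ∂P) q) := by
    intro q
    induction q using MvPolynomial.induction_on with
    | C x => rw [hψC]; simp
    | add p q hp hq => rw [map_add, map_add, map_add, map_add, map_add, ← hp, ← hq]; ring
    | mul_X q t hq =>
      rw [map_mul, Derivation.leibniz, Derivation.leibniz, Derivation.leibniz, hψX,
        constDeriv_X, map_add]
      simp only [smul_eq_mul, map_mul, map_add]
      rw [← hq, hψC, hψX, hcov]
      simp only [map_add, Derivation.leibniz, constDeriv_X, constDeriv_C, smul_eq_mul, map_mul]
      ring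
  rw [hψ, hψ, map_mul, hψX, add_mul, map_add, hGI, ← hD, map_add, mul_assoc,
    ← MvPolynomial.smul_eq_C_mul, ← MvPolynomial.smul_eq_C_mul, map_smul, map_smul, hGI]

end Moments

/-! ### Loop equations for matrices of Gaussian variables -/

lemma splitSum_matrix_apply {S m n A : Type*} [AddCommMonoid A]
    (φ : List S → S → List S → Matrix m n A) (l : List S) (i : m) (j : n) :
    (splitSum φ l : Matrix m n A) i j = splitSum (fun a g b => φ a g b i j) l :=
  map_splitSum (Matrix.entryAddMonoidHom A i j) φ l

lemma splitSum_trace {S m A : Type*} [Fintype m] [AddCommMonoid A]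
    (φ : List S → S → List S → Matrix m m A) (l : List S) :
    (splitSum φ l : Matrix m m A).trace = splitSum (fun a g b => (φ a g b).trace) l :=
  map_splitSum (Matrix.traceAddMonoidHom m A) φ l

section Loop

variable {V : Type*} [NormedAddCommGroup V] [InnerProductSpace ℝ V] {N : ℕ}

/-- Polynomials in the entries of a family of `N × N` matrices. -/
abbrev EntryPoly (V : Type*) (N : ℕ) := MvPolynomial (V × Fin N × Fin N) ℂ

/-- The matrix of the variables with index `f`. -/
noncomputable def genMat (N : ℕ) (f : V) : Matrix (Fin N) (Fin N) (EntryPoly V N) :=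
  fun i j => MvPolynomial.X (f, i, j)

/-- The derivation which pairs with the variable `(f, i, j)` in Gaussian integration by parts. -/
noncomputable def entryDeriv (f : V) (i j : Fin N) :
    Derivation ℂ (EntryPoly V N) (EntryPoly V N) :=
  constDeriv fun s => if s.2 = (j, i) then (1 / N : ℂ) * (inner ℝ f s.1 : ℝ) else 0

/-- `entryDeriv`, applied to all entries of a matrix. -/
noncomputable def matDeriv (f : V) (i j : Fin N) :
    Matrix (Fin N) (Fin N) (EntryPoly V N) →ₗ[ℂ] Matrix (Fin N) (Fin N) (EntryPoly V N) :=
  (entryDeriv f i j : EntryPoly V N →ₗ[ℂ] EntryPoly V N).mapMatrix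

lemma matDeriv_apply (f : V) (i j : Fin N) (M : Matrix (Fin N) (Fin N) (EntryPoly V N))
    (k l : Fin N) : matDeriv f i j M k l = entryDeriv f i j (M k l) := rfl

lemma matDeriv_mul (f : V) (i j : Fin N) (A B : Matrix (Fin N) (Fin N) (EntryPoly V N)) :
    matDeriv f i j (A * B) = matDeriv f i j A * B + A * matDeriv f i j B := by
  ext1 k l
  simp only [matDeriv_apply, Matrix.mul_apply, Matrix.add_apply, map_sum, Derivation.leibniz,
    smul_eq_mul, ← Finset.sum_add_distrib]
  exact Finset.sum_congr rfl fun _ _ => by ring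

/-- The matrix unit has transposed indices because in a Hermitian ensemble entry `(i, j)` has
nonzero bilinear covariance only with entry `(j, i)`. -/
lemma matDeriv_genMat (f g : V) (i j : Fin N) :
    matDeriv f i j (genMat N g) =
      ((1 / N : ℂ) * (inner ℝ f g : ℝ)) • Matrix.single j i (1 : EntryPoly V N) := by
  ext1 k l
  rw [matDeriv_apply, genMat, entryDeriv, constDeriv_X, Matrix.smul_apply, Matrix.single_apply]
  by_cases h : k = j ∧ l = i
  · rw [if_pos (by simp [h.1, h.2]), if_pos (by simp [h.1, h.2]), MvPolynomial.smul_eq_C_mul,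
      mul_one]
  · rw [if_neg (by simpa using h), if_neg (by simpa [eq_comm] using h)]
    simp

lemma mul_single_mul_apply (A B : Matrix (Fin N) (Fin N) (EntryPoly V N)) (j i k l : Fin N) :
    (A * Matrix.single j i (1 : EntryPoly V N) * B) k l = A k j * B i l := by
  rw [Matrix.mul_assoc, Matrix.mul_apply, Finset.sum_eq_single j]
  · rw [Matrix.single_mul_apply_same, one_mul]
  · intro m _ hm
    rw [Matrix.single_mul_apply_of_ne _ _ _ _ _ hm, mul_zero]
  · simp

/-- The matrix unit cuts the trace open and reverses the order of the two parts; this is where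
cyclic derivatives come from. -/
lemma trace_mul_single_mul (A B : Matrix (Fin N) (Fin N) (EntryPoly V N)) (j i : Fin N) :
    (A * Matrix.single j i (1 : EntryPoly V N) * B).trace = (B * A) i j := by
  simp only [Matrix.trace, Matrix.diag_apply, mul_single_mul_apply]
  rw [Matrix.mul_apply]
  exact Finset.sum_congr rfl fun _ _ => mul_comm _ _

lemma entryDeriv_trace (f : V) (i j : Fin N) (M : Matrix (Fin N) (Fin N) (EntryPoly V N)) :
    entryDeriv f i j M.trace = (matDeriv f i j M).trace := by
  simp only [Matrix.trace, Matrix.diag_apply, map_sum, matDeriv_apply]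

/-- The derivatives of a matrix `M` are given by a sum over the letters of `u`, as for words. -/
def HasWordDeriv (M : Matrix (Fin N) (Fin N) (EntryPoly V N))
    (W : List V → Matrix (Fin N) (Fin N) (EntryPoly V N)) (u : List V) : Prop :=
  ∀ f i j, matDeriv f i j M = splitSum (fun a g b =>
    ((1 / N : ℂ) * (inner ℝ f g : ℝ)) • (W a * Matrix.single j i 1 * W b)) u

lemma hasWordDeriv_prod (u : List V) :
    HasWordDeriv (u.map (genMat N)).prod (fun a => (a.map (genMat N)).prod) u := by
  intro f i j
  have := derivation_list_prod (genMat N) (matDeriv f i j : _ →ₗ[ℂ] _).toAddMonoidHom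
    (matDeriv_mul f i j) u
  refine this.trans (splitSum_congr fun a g b _ => ?_)
  rw [LinearMap.toAddMonoidHom_coe, matDeriv_genMat, mul_smul_comm, smul_mul_assoc]

/-- Together with `hasWordDeriv_prod` this lets one Schwinger–Dyson equation serve plain words, for
bounds, and Wick words, for limits. -/
lemma hasWordDeriv_wickIn (u : List V) :
    HasWordDeriv (wickIn (genMat N) u) (wickIn (genMat N)) u := fun f i j =>
  derivation_wickIn (genMat N) (matDeriv f i j) (matDeriv_mul f i j) f _ _
    (fun g => matDeriv_genMat f g i j) u

lemma HasWordDeriv.entryDeriv_trace {M : Matrix (Fin N) (Fin N) (EntryPoly V N)}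
    {W : List V → Matrix (Fin N) (Fin N) (EntryPoly V N)} {u : List V} (h : HasWordDeriv M W u)
    (f : V) (i j : Fin N) :
    entryDeriv f i j M.trace =
      splitSum (fun a g b => ((1 / N : ℂ) * (inner ℝ f g : ℝ)) • (W b * W a)) u i j := by
  rw [CyclicFock.entryDeriv_trace, h f i j, splitSum_matrix_apply, splitSum_trace]
  refine splitSum_congr fun a g b _ => ?_
  rw [Matrix.trace_smul, trace_mul_single_mul]
  rfl

/-- A normalized functional on polynomials satisfying Gaussian integration by parts. -/
structure IsGaussianFunctional (E : EntryPoly V N →ₗ[ℂ] ℂ) : Prop where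
  one : E 1 = 1
  ibp : ∀ f i j p, E (MvPolynomial.X (f, i, j) * p) = E (entryDeriv f i j p)

/-- The Schwinger–Dyson equation. -/
lemma IsGaussianFunctional.trace_mul {E : EntryPoly V N →ₗ[ℂ] ℂ} (hE : IsGaussianFunctional E)
    (f : V) {M : Matrix (Fin N) (Fin N) (EntryPoly V N)}
    {W : List V → Matrix (Fin N) (Fin N) (EntryPoly V N)} {u : List V} (h : HasWordDeriv M W u)
    {G : EntryPoly V N} {Γ : Matrix (Fin N) (Fin N) (EntryPoly V N)}
    (hΓ : ∀ i j, entryDeriv f i j G = Γ i j) :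
    E ((genMat N f * M).trace * G) =
      splitSum (fun a g b => (1 / N : ℂ) * (inner ℝ f g : ℝ) *
        E ((W a).trace * (W b).trace * G)) u + E (M * Γ).trace := by
  have h1 : (genMat N f * M).trace * G =
      ∑ i, ∑ j, MvPolynomial.X (f, i, j) * (M j i * G) := by
    simp only [Matrix.trace, Matrix.diag_apply, Matrix.mul_apply, genMat, Finset.sum_mul, mul_assoc]
  -- The derivative falls either on `M`, where summation over `i` and `j` yields two separate
  -- traces, or on `G`, which yields a trace of `M * Γ`.
  have h2 : ∀ i j, E (MvPolynomial.X (f, i, j) * (M j i * G)) =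
      E (matDeriv f i j M j i * G) + E (M j i * Γ i j) := by
    intro i j
    rw [hE.ibp, Derivation.leibniz, map_add, hΓ, smul_eq_mul, smul_eq_mul, matDeriv_apply,
      mul_comm G, add_comm]
  have h3 : ∀ i j, E (matDeriv f i j M j i * G) = splitSum (fun a g b =>
      (1 / N : ℂ) * (inner ℝ f g : ℝ) * E (W a j j * W b i i * G)) u := by
    intro i j
    rw [h f i j, splitSum_matrix_apply, splitSum_mul, map_splitSum]
    refine splitSum_congr fun a g b _ => ?_
    rw [Matrix.smul_apply, mul_single_mul_apply, smul_mul_assoc, map_smul, smul_eq_mul]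
  rw [h1]
  simp only [map_sum, h2, Finset.sum_add_distrib, h3, sum_splitSum]
  congr 1
  · refine splitSum_congr fun a g b _ => ?_
    rw [Finset.sum_comm]
    simp only [← Finset.mul_sum, ← map_sum, Matrix.trace, Matrix.diag_apply, ← Finset.sum_mul]
  · rw [Finset.sum_comm]
    simp only [← map_sum, Matrix.trace, Matrix.diag_apply, Matrix.mul_apply]

/-! ### Centered traces and their recursion. -/

/-- The trace of a word. -/
noncomputable def wordTrace (N : ℕ) (u : List V) : EntryPoly V N :=
  (u.map (genMat N)).prod.trace

/-- The centered trace of a word. -/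
noncomputable def centeredTrace (E : EntryPoly V N →ₗ[ℂ] ℂ) (u : List V) : EntryPoly V N :=
  wordTrace N u - MvPolynomial.C (E (wordTrace N u))

/-- The joint moments of the centered traces of words. -/
noncomputable def centeredMoment (E : EntryPoly V N →ₗ[ℂ] ℂ) (ws : List (List V)) : ℂ :=
  E (ws.map (centeredTrace E)).prod

lemma entryDeriv_prod_centeredTrace (E : EntryPoly V N →ₗ[ℂ] ℂ) (f : V) (i j : Fin N)
    (ws : List (List V)) :
    entryDeriv f i j (ws.map (centeredTrace E)).prod =
      splitSum (fun A w B => (((A ++ B).map (centeredTrace E)).prod •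
        splitSum (fun a g b => ((1 / N : ℂ) * (inner ℝ f g : ℝ)) •
          ((b.map (genMat N)).prod * (a.map (genMat N)).prod)) w)) ws i j := by
  have h := derivation_list_prod (centeredTrace E)
    (entryDeriv f i j : EntryPoly V N →ₗ[ℂ] EntryPoly V N).toAddMonoidHom
    (by
      intro x y
      have := (entryDeriv f i j).leibniz x y
      simp only [smul_eq_mul] at this
      change entryDeriv f i j (x * y) = _
      rw [this, add_comm, mul_comm y]
      rfl) ws
  rw [splitSum_matrix_apply]
  refine Eq.trans h (splitSum_congr fun A w B _ => ?_)
  have h1 : entryDeriv f i j (centeredTrace E w) = entryDeriv f i j (wordTrace N w) := by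
    rw [centeredTrace, map_sub]
    simp only [entryDeriv, constDeriv_C, sub_zero]
  change _ * entryDeriv f i j (centeredTrace E w) * _ = _
  rw [h1, wordTrace, (hasWordDeriv_prod w).entryDeriv_trace, Matrix.smul_apply,
    List.map_append, List.prod_append, smul_eq_mul]
  ring

/-- The letter `f` pairs either inside its own word, splitting the trace in two, or with a letter of
another word, merging the two traces. -/
lemma IsGaussianFunctional.wordTrace_cons_mul {E : EntryPoly V N →ₗ[ℂ] ℂ}
    (hE : IsGaussianFunctional E) (f : V) (u : List V) (ws : List (List V)) :
    E (wordTrace N (f :: u) * (ws.map (centeredTrace E)).prod) =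
      splitSum (fun a g b => (1 / N : ℂ) * (inner ℝ f g : ℝ) *
        E (wordTrace N a * wordTrace N b * (ws.map (centeredTrace E)).prod)) u +
      splitSum (fun A w B => splitSum (fun a g b => (1 / N : ℂ) * (inner ℝ f g : ℝ) *
        E (wordTrace N (u ++ b ++ a) * ((A ++ B).map (centeredTrace E)).prod)) w) ws := by
  have h := hE.trace_mul f (hasWordDeriv_prod u) 
    (fun i j => entryDeriv_prod_centeredTrace E f i j ws)
  rw [wordTrace, List.map_cons, List.prod_cons, h]
  congr 1
  rw [mul_splitSum, splitSum_trace, map_splitSum]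
  refine splitSum_congr fun A w B _ => ?_
  rw [smul_splitSum, mul_splitSum, splitSum_trace, map_splitSum]
  refine splitSum_congr fun a g b _ => ?_
  rw [smul_comm, mul_smul_comm, mul_smul_comm, Matrix.trace_smul, map_smul, Matrix.trace_smul,
    smul_eq_mul, smul_eq_mul, mul_comm (List.prod _) (Matrix.trace _)]
  congr 3
  simp only [wordTrace, List.map_append, List.prod_append, mul_assoc]

lemma IsGaussianFunctional.apply_C {E : EntryPoly V N →ₗ[ℂ] ℂ} (hE : IsGaussianFunctional E)
    (c : ℂ) : E (MvPolynomial.C c) = c := by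
  have := E.map_smul c 1
  rwa [hE.one, MvPolynomial.smul_eq_C_mul, mul_one, smul_eq_mul, mul_one] at this

lemma apply_C_mul (E : EntryPoly V N →ₗ[ℂ] ℂ) (c : ℂ) (p : EntryPoly V N) :
    E (MvPolynomial.C c * p) = c * E p := by
  rw [← MvPolynomial.smul_eq_C_mul, map_smul, smul_eq_mul]

lemma wordTrace_eq (E : EntryPoly V N →ₗ[ℂ] ℂ) (u : List V) :
    wordTrace N u = centeredTrace E u + MvPolynomial.C (E (wordTrace N u)) := by
  rw [centeredTrace, sub_add_cancel]

lemma IsGaussianFunctional.apply_centeredTrace {E : EntryPoly V N →ₗ[ℂ] ℂ}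
    (hE : IsGaussianFunctional E) (u : List V) : E (centeredTrace E u) = 0 := by
  rw [centeredTrace, map_sub, hE.apply_C, sub_self]

lemma centeredMoment_cons (E : EntryPoly V N →ₗ[ℂ] ℂ) (w : List V) (ws : List (List V)) :
    E (wordTrace N w * (ws.map (centeredTrace E)).prod) =
      centeredMoment E (w :: ws) + E (wordTrace N w) * centeredMoment E ws := by
  conv_lhs => rw [wordTrace_eq E w, add_mul, map_add, apply_C_mul]
  rw [centeredMoment, List.map_cons, List.prod_cons, centeredMoment]

lemma apply_wordTrace_mul_wordTrace_mul (E : EntryPoly V N →ₗ[ℂ] ℂ) (a b : List V)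
    (ws : List (List V)) :
    E (wordTrace N a * wordTrace N b * (ws.map (centeredTrace E)).prod) =
      centeredMoment E (a :: b :: ws) + E (wordTrace N a) * centeredMoment E (b :: ws) +
        E (wordTrace N b) * centeredMoment E (a :: ws) +
        E (wordTrace N a) * E (wordTrace N b) * centeredMoment E ws := by
  have h : wordTrace N a * wordTrace N b * (ws.map (centeredTrace E)).prod =
      centeredTrace E a * (centeredTrace E b * (ws.map (centeredTrace E)).prod) +
      MvPolynomial.C (E (wordTrace N a)) * (centeredTrace E b * (ws.map (centeredTrace E)).prod) +
      MvPolynomial.C (E (wordTrace N b)) * (centeredTrace E a * (ws.map (centeredTrace E)).prod) +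
      MvPolynomial.C (E (wordTrace N a)) *
        (MvPolynomial.C (E (wordTrace N b)) * (ws.map (centeredTrace E)).prod) := by
    simp only [centeredTrace]; ring
  rw [h, map_add, map_add, map_add, apply_C_mul, apply_C_mul, apply_C_mul, apply_C_mul]
  simp only [centeredMoment, List.map_cons, List.prod_cons, mul_assoc]

lemma IsGaussianFunctional.centeredMoment_nil {E : EntryPoly V N →ₗ[ℂ] ℂ}
    (hE : IsGaussianFunctional E) : centeredMoment E ([] : List (List V)) = 1 := by
  simp [centeredMoment, hE.one]

lemma IsGaussianFunctional.centeredMoment_singleton {E : EntryPoly V N →ₗ[ℂ] ℂ}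
    (hE : IsGaussianFunctional E) (w : List V) : centeredMoment E [w] = 0 := by
  simp [centeredMoment, hE.apply_centeredTrace]

lemma IsGaussianFunctional.apply_wordTrace_nil {E : EntryPoly V N →ₗ[ℂ] ℂ}
    (hE : IsGaussianFunctional E) : E (wordTrace N ([] : List V)) = N := by
  have : wordTrace N ([] : List V) = MvPolynomial.C (N : ℂ) := by simp [wordTrace]
  rw [this, hE.apply_C]

lemma IsGaussianFunctional.centeredMoment_nil_cons {E : EntryPoly V N →ₗ[ℂ] ℂ}
    (hE : IsGaussianFunctional E) (ws : List (List V)) : centeredMoment E ([] :: ws) = 0 := by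
  have : centeredTrace E ([] : List V) = 0 := by
    rw [centeredTrace, hE.apply_wordTrace_nil]
    simp [wordTrace]
  simp [centeredMoment, this]

lemma IsGaussianFunctional.apply_wordTrace_cons {E : EntryPoly V N →ₗ[ℂ] ℂ}
    (hE : IsGaussianFunctional E) (f : V) (u : List V) :
    E (wordTrace N (f :: u)) = splitSum (fun a g b => (1 / N : ℂ) * (inner ℝ f g : ℝ) *
      (centeredMoment E [a, b] + E (wordTrace N a) * E (wordTrace N b))) u := by
  have h := hE.wordTrace_cons_mul f u []
  simp only [List.map_nil, List.prod_nil, mul_one, splitSum_nil, add_zero] at h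
  rw [h]
  refine splitSum_congr fun a g b _ => ?_
  have := apply_wordTrace_mul_wordTrace_mul E a b []
  simp only [List.map_nil, List.prod_nil, mul_one, hE.centeredMoment_singleton,
    hE.centeredMoment_nil, mul_zero, add_zero] at this
  rw [this]

/-- Centering removes the terms with two expected traces, the only ones of order `N`. Each remaining
expected trace comes with a factor `1 / N`, and the total degree drops by two. -/
lemma IsGaussianFunctional.centeredMoment_cons_cons {E : EntryPoly V N →ₗ[ℂ] ℂ}
    (hE : IsGaussianFunctional E) (f : V) (u : List V) (ws : List (List V)) :
    centeredMoment E ((f :: u) :: ws) =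
      splitSum (fun a g b => (1 / N : ℂ) * (inner ℝ f g : ℝ) *
        (centeredMoment E (a :: b :: ws) - centeredMoment E [a, b] * centeredMoment E ws +
          E (wordTrace N a) * centeredMoment E (b :: ws) +
          E (wordTrace N b) * centeredMoment E (a :: ws))) u +
      splitSum (fun A w B => splitSum (fun a g b => (1 / N : ℂ) * (inner ℝ f g : ℝ) *
        (centeredMoment E ((u ++ b ++ a) :: (A ++ B)) +
          E (wordTrace N (u ++ b ++ a)) * centeredMoment E (A ++ B))) w) ws := by
  have h := hE.wordTrace_cons_mul f u ws
  rw [centeredMoment_cons, hE.apply_wordTrace_cons, splitSum_mul] at h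
  rw [← eq_sub_iff_add_eq, add_sub_right_comm, ← splitSum_sub] at h
  rw [h]
  congr 1
  · refine splitSum_congr fun a g b _ => ?_
    rw [apply_wordTrace_mul_wordTrace_mul]
    ring
  · refine splitSum_congr fun A w B _ => splitSum_congr fun a g b _ => ?_
    rw [centeredMoment_cons]

end Loop

/-! ### Boundedness of moments -/

/-- A sequence of complex numbers which is bounded from some index on. -/
def IsBdd (s : ℕ → ℂ) : Prop := s =O[atTop] fun _ => (1 : ℝ)

lemma IsBdd.add {s t : ℕ → ℂ} (hs : IsBdd s) (ht : IsBdd t) : IsBdd fun N => s N + t N :=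
  Asymptotics.IsBigO.add hs ht

lemma IsBdd.sub {s t : ℕ → ℂ} (hs : IsBdd s) (ht : IsBdd t) : IsBdd fun N => s N - t N :=
  Asymptotics.IsBigO.sub hs ht

lemma IsBdd.mul {s t : ℕ → ℂ} (hs : IsBdd s) (ht : IsBdd t) : IsBdd fun N => s N * t N := by
  have := Asymptotics.IsBigO.mul hs ht
  simpa [IsBdd] using this

lemma isBdd_const (c : ℂ) : IsBdd fun _ => c := Asymptotics.isBigO_const_const c one_ne_zero _

lemma isBdd_of_tendsto {s : ℕ → ℂ} {c : ℂ} (h : Tendsto s atTop (𝓝 c)) : IsBdd s :=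
  h.isBigO_one ℝ

lemma tendsto_inv_nat : Tendsto (fun N : ℕ => (1 / N : ℂ)) atTop (𝓝 0) := by
  simpa using tendsto_inv_atTop_nhds_zero_nat (𝕜 := ℂ)

lemma isBdd_inv_nat : IsBdd fun N : ℕ => (1 / N : ℂ) := isBdd_of_tendsto tendsto_inv_nat

lemma IsBdd.tendsto_mul {s t : ℕ → ℂ} (hs : Tendsto s atTop (𝓝 0)) (ht : IsBdd t) :
    Tendsto (fun N => s N * t N) atTop (𝓝 0) := by
  have h := ((Asymptotics.isLittleO_one_iff ℝ).2 hs).mul_isBigO ht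
  simp only [mul_one] at h
  exact (Asymptotics.isLittleO_one_iff ℝ).1 h

lemma isBdd_splitSum {S : Type*} {φ : ℕ → List S → S → List S → ℂ} {u : List S}
    (h : ∀ a g b, a ++ g :: b = u → IsBdd fun N => φ N a g b) :
    IsBdd fun N => splitSum (φ N) u := by
  induction u generalizing φ with
  | nil => simpa using isBdd_const 0
  | cons g l ih =>
    simp only [splitSum_cons]
    exact (h [] g l rfl).add (ih fun a g' b e => h _ _ _ (by simp [e]))

lemma tendsto_splitSum {S : Type*} {φ : ℕ → List S → S → List S → ℂ}
    {ψ : List S → S → List S → ℂ} {u : List S}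
    (h : ∀ a g b, a ++ g :: b = u → Tendsto (fun N => φ N a g b) atTop (𝓝 (ψ a g b))) :
    Tendsto (fun N => splitSum (φ N) u) atTop (𝓝 (splitSum ψ u)) := by
  induction u generalizing φ ψ with
  | nil => simp
  | cons g l ih =>
    simp only [splitSum_cons]
    exact (h [] g l rfl).add (ih fun a g' b e => h _ _ _ (by simp [e]))

section Asymptotics

variable {V : Type*} [NormedAddCommGroup V] [InnerProductSpace ℝ V]
variable {E : ∀ N, EntryPoly V N →ₗ[ℂ] ℂ}

/-- The two bounds need each other: expected traces involve covariances, and centered moments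
involve normalized traces. Both recursions lower the degree, so one strong induction on `d` proves
them together. -/
lemma isBdd_moments (hE : ∀ N, IsGaussianFunctional (E N)) (d : ℕ) :
    (∀ w : List V, w.length ≤ d → IsBdd fun N : ℕ => 1 / (N : ℂ) * E N (wordTrace N w)) ∧
      ∀ ws : List (List V), (ws.map List.length).sum ≤ d →
        IsBdd fun N => centeredMoment (E N) ws := by
  induction d using Nat.strong_induction_on with
  | _ d ih =>
    have hc : ∀ w : List V, w.length < d → IsBdd fun N : ℕ => 1 / (N : ℂ) * E N (wordTrace N w) :=
      fun w hw => (ih _ hw).1 w le_rfl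
    have hm : ∀ ws : List (List V), (ws.map List.length).sum < d →
        IsBdd fun N => centeredMoment (E N) ws := fun ws hws => (ih _ hws).2 ws le_rfl
    have hc' : ∀ w : List V, w.length ≤ d →
        IsBdd fun N : ℕ => 1 / (N : ℂ) * E N (wordTrace N w) := by
      intro w hw
      cases w with
      | nil =>
        simp only [(hE _).apply_wordTrace_nil]
        refine isBdd_of_tendsto (c := 1) (tendsto_const_nhds.congr' ?_)
        filter_upwards [eventually_ne_atTop 0] with N hN
        field_simp
      | cons f u =>
        simp only [(hE _).apply_wordTrace_cons, mul_splitSum]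
        refine isBdd_splitSum fun a g b e => ?_
        have hl : a.length + b.length + 1 = u.length := by rw [← e]; simp; omega
        simp only [List.length_cons] at hw
        have h1 := hm [a, b] (by simp; omega)
        have h2 := hc a (by omega)
        have h3 := hc b (by omega)
        refine ((isBdd_const ((inner ℝ f g : ℝ) : ℂ)).mul
          (((isBdd_inv_nat.mul isBdd_inv_nat).mul h1).add (h2.mul h3))).congr_left fun N => ?_
        ring
    refine ⟨hc', fun ws hws => ?_⟩
    match ws with
    | [] => simpa only [(hE _).centeredMoment_nil] using isBdd_const 1
    | [] :: ws => simpa only [(hE _).centeredMoment_nil_cons] using isBdd_const 0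
    | (f :: u) :: ws =>
      simp only [List.map_cons, List.length_cons, List.sum_cons] at hws
      simp only [(hE _).centeredMoment_cons_cons]
      refine IsBdd.add (isBdd_splitSum fun a g b e => ?_)
        (isBdd_splitSum fun A w B e => isBdd_splitSum fun a g b e' => ?_)
      · have hl : a.length + b.length + 1 = u.length := by rw [← e]; simp; omega
        have h1 := hm (a :: b :: ws) (by simp; omega)
        have h2 := hm [a, b] (by simp; omega)
        have h3 := hm ws (by omega)
        have h4 := hm (b :: ws) (by simp; omega)
        have h5 := hm (a :: ws) (by simp; omega)
        have h6 := hc a (by omega)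
        have h7 := hc b (by omega)
        refine ((isBdd_const ((inner ℝ f g : ℝ) : ℂ)).mul
          ((isBdd_inv_nat.mul (h1.sub (h2.mul h3))).add
            ((h6.mul h4).add (h7.mul h5)))).congr_left fun N => ?_
        ring
      · have hl : a.length + b.length + 1 = w.length := by rw [← e']; simp; omega
        have hl' : (A.map List.length).sum + (B.map List.length).sum + w.length =
            (ws.map List.length).sum := by rw [← e]; simp; omega
        have h1 := hm ((u ++ b ++ a) :: (A ++ B)) (by simp; omega)
        have h2 := hc (u ++ b ++ a) (by simp; omega)
        have h3 := hm (A ++ B) (by simp; omega)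
        refine ((isBdd_const ((inner ℝ f g : ℝ) : ℂ)).mul
          ((isBdd_inv_nat.mul h1).add (h2.mul h3))).congr_left fun N => ?_
        ring

/-! ### Traces of noncommutative polynomials -/

/-- The product of the letters of a word in the free algebra. -/
noncomputable def freeWord (u : List V) : FreeAlgebra ℂ V := (u.map (FreeAlgebra.ι ℂ)).prod

lemma freeAlgebra_induction {p : FreeAlgebra ℂ V → Prop} (hw : ∀ u, p (freeWord u))
    (hadd : ∀ x y, p x → p y → p (x + y)) (hsmul : ∀ (c : ℂ) x, p x → p (c • x))
    (x : FreeAlgebra ℂ V) : p x := by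
  have key : ∀ y : FreeAlgebra ℂ V,
      y ∈ Submodule.span ℂ (Set.range (freeWord : List V → FreeAlgebra ℂ V)) := by
    intro y
    induction y using FreeAlgebra.induction with
    | grade0 r =>
      rw [Algebra.algebraMap_eq_smul_one]
      exact Submodule.smul_mem _ _ (Submodule.subset_span ⟨[], rfl⟩)
    | grade1 f => exact Submodule.subset_span ⟨[f], by simp [freeWord]⟩
    | mul a b ha hb =>
      have h := Submodule.mul_mem_mul ha hb
      rw [Submodule.span_mul_span] at h
      refine Submodule.span_mono ?_ h
      rintro _ ⟨_, ⟨l, rfl⟩, _, ⟨l', rfl⟩, rfl⟩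
      exact ⟨l ++ l', by simp [freeWord]⟩
    | add a b ha hb => exact Submodule.add_mem _ ha hb
  induction key x using Submodule.span_induction with
  | mem x hx => obtain ⟨u, rfl⟩ := hx; exact hw u
  | zero => simpa using hsmul 0 _ (hw [])
  | add x y _ _ hx hy => exact hadd x y hx hy
  | smul c x _ hx => exact hsmul c x hx

/-- The trace of a noncommutative polynomial in the matrices. -/
noncomputable def freeTrace (N : ℕ) : FreeAlgebra ℂ V →ₗ[ℂ] EntryPoly V N :=
  Matrix.traceLinearMap (Fin N) ℂ (EntryPoly V N) ∘ₗ
    (FreeAlgebra.lift ℂ (genMat (V := V) N)).toLinearMap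

lemma freeTrace_apply (N : ℕ) (x : FreeAlgebra ℂ V) :
    freeTrace N x = (FreeAlgebra.lift ℂ (genMat N) x).trace := rfl

lemma freeTrace_freeWord (N : ℕ) (u : List V) : freeTrace N (freeWord u) = wordTrace N u := by
  rw [freeTrace_apply, freeWord, map_list_prod, List.map_map, wordTrace]
  congr 3
  funext f
  simp

/-- The centered trace of a noncommutative polynomial in the matrices. -/
noncomputable def freeCentered {N : ℕ} (E : EntryPoly V N →ₗ[ℂ] ℂ) :
    FreeAlgebra ℂ V →ₗ[ℂ] EntryPoly V N :=
  freeTrace N - Algebra.linearMap ℂ (EntryPoly V N) ∘ₗ E ∘ₗ freeTrace N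

lemma freeCentered_apply {N : ℕ} (E : EntryPoly V N →ₗ[ℂ] ℂ) (x : FreeAlgebra ℂ V) :
    freeCentered E x = freeTrace N x - MvPolynomial.C (E (freeTrace N x)) := rfl

lemma IsGaussianFunctional.apply_freeCentered {N : ℕ} {E : EntryPoly V N →ₗ[ℂ] ℂ}
    (hE : IsGaussianFunctional E) (x : FreeAlgebra ℂ V) : E (freeCentered E x) = 0 := by
  rw [freeCentered_apply, map_sub, hE.apply_C, sub_self]

lemma freeCentered_freeWord {N : ℕ} (E : EntryPoly V N →ₗ[ℂ] ℂ) (u : List V) :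
    freeCentered E (freeWord u) = centeredTrace E u := by
  rw [freeCentered_apply, freeTrace_freeWord, centeredTrace]

/-- Extends the bound from words by trilinearity; the covariance equation contains no higher
centered moments than these. -/
lemma isBdd_freeCentered_three (hE : ∀ N, IsGaussianFunctional (E N))
    (x y z : FreeAlgebra ℂ V) :
    IsBdd fun N => E N (freeCentered (E N) x * freeCentered (E N) y * freeCentered (E N) z) := by
  induction x using freeAlgebra_induction with
  | hadd x x' hx hx' => simpa only [map_add, add_mul] using hx.add hx'
  | hsmul c x hx =>
    simpa only [map_smul, smul_mul_assoc, smul_eq_mul] using (isBdd_const c).mul hx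
  | hw u =>
    induction y using freeAlgebra_induction with
    | hadd x x' hx hx' => simpa only [map_add, add_mul, mul_add] using hx.add hx'
    | hsmul c x hx =>
      simpa only [map_smul, smul_mul_assoc, mul_smul_comm, smul_eq_mul] using
        (isBdd_const c).mul hx
    | hw v =>
      induction z using freeAlgebra_induction with
      | hadd x x' hx hx' => simpa only [map_add, mul_add] using hx.add hx'
      | hsmul c x hx =>
        simpa only [map_smul, mul_smul_comm, smul_eq_mul] using (isBdd_const c).mul hx
      | hw w =>
        have := (isBdd_moments hE _).2 [u, v, w] le_rfl
        simpa [centeredMoment, freeCentered_freeWord, mul_assoc] using this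

lemma isBdd_freeCentered_two (hE : ∀ N, IsGaussianFunctional (E N)) (x y : FreeAlgebra ℂ V) :
    IsBdd fun N => E N (freeCentered (E N) x * freeCentered (E N) y) := by
  induction x using freeAlgebra_induction with
  | hadd x x' hx hx' => simpa only [map_add, add_mul] using hx.add hx'
  | hsmul c x hx =>
    simpa only [map_smul, smul_mul_assoc, smul_eq_mul] using (isBdd_const c).mul hx
  | hw u =>
    induction y using freeAlgebra_induction with
    | hadd x x' hx hx' => simpa only [map_add, mul_add] using hx.add hx'
    | hsmul c x hx =>
      simpa only [map_smul, mul_smul_comm, smul_eq_mul] using (isBdd_const c).mul hx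
    | hw v =>
      have := (isBdd_moments hE _).2 [u, v] le_rfl
      simpa [centeredMoment, freeCentered_freeWord] using this

/-! ### Limits for Wick words -/

/-- The Wick words in the free algebra. -/
noncomputable abbrev freeWick (u : List V) : FreeAlgebra ℂ V := wickIn (FreeAlgebra.ι ℂ) u

lemma lift_freeWick (N : ℕ) (u : List V) :
    FreeAlgebra.lift ℂ (genMat N) (freeWick u) = wickIn (genMat N) u := by
  rw [freeWick, map_wickIn]
  congr 1
  funext f
  simp

lemma freeTrace_freeWick (N : ℕ) (u : List V) :
    freeTrace N (freeWick u) = (wickIn (genMat N) u).trace := by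
  rw [freeTrace_apply, lift_freeWick]

lemma freeTrace_ι_mul_freeWick (N : ℕ) (f : V) (u : List V) :
    freeTrace N (FreeAlgebra.ι ℂ f * freeWick u) = (genMat N f * wickIn (genMat N) u).trace := by
  rw [freeTrace_apply, map_mul, lift_freeWick, FreeAlgebra.lift_ι_apply]

lemma apply_freeTrace_mul_freeTrace {N : ℕ} {E : EntryPoly V N →ₗ[ℂ] ℂ}
    (hE : IsGaussianFunctional E) (x y : FreeAlgebra ℂ V) :
    E (freeTrace N x * freeTrace N y) = E (freeCentered E x * freeCentered E y) +
      E (freeTrace N x) * E (freeTrace N y) := by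
  have h : freeTrace N x * freeTrace N y = freeCentered E x * freeCentered E y +
      MvPolynomial.C (E (freeTrace N x)) * freeCentered E y +
      MvPolynomial.C (E (freeTrace N y)) * freeCentered E x +
      MvPolynomial.C (E (freeTrace N x)) * MvPolynomial.C (E (freeTrace N y)) := by
    rw [freeCentered_apply, freeCentered_apply]; ring
  rw [h, map_add, map_add, map_add, apply_C_mul, apply_C_mul, apply_C_mul, hE.apply_C,
    hE.apply_freeCentered, hE.apply_freeCentered]
  ring

/-- A split trace is a product of two traces; this expresses its covariance with a third through
quantities whose size is known. -/
lemma apply_freeTrace_mul_mul_sub {N : ℕ} {E : EntryPoly V N →ₗ[ℂ] ℂ}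
    (hE : IsGaussianFunctional E) (x y z : FreeAlgebra ℂ V) :
    E (freeTrace N x * freeTrace N y * freeTrace N z) -
        E (freeTrace N x * freeTrace N y) * E (freeTrace N z) =
      E (freeCentered E x * freeCentered E y * freeCentered E z) +
        E (freeTrace N x) * E (freeCentered E y * freeCentered E z) +
        E (freeTrace N y) * E (freeCentered E x * freeCentered E z) := by
  have h1 : E (freeTrace N x * freeTrace N y * freeTrace N z) -
        E (freeTrace N x * freeTrace N y) * E (freeTrace N z) =
      E (freeTrace N x * freeTrace N y * freeCentered E z) := by
    rw [freeCentered_apply E z, mul_sub, map_sub, mul_comm _ (MvPolynomial.C _), apply_C_mul]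
    ring
  have h2 : freeTrace N x * freeTrace N y * freeCentered E z =
      freeCentered E x * freeCentered E y * freeCentered E z +
      MvPolynomial.C (E (freeTrace N x)) * (freeCentered E y * freeCentered E z) +
      MvPolynomial.C (E (freeTrace N y)) * (freeCentered E x * freeCentered E z) +
      MvPolynomial.C (E (freeTrace N x)) * (MvPolynomial.C (E (freeTrace N y)) *
        freeCentered E z) := by
    rw [freeCentered_apply E x, freeCentered_apply E y]; ring
  rw [h1, h2, map_add, map_add, map_add, apply_C_mul, apply_C_mul, apply_C_mul, apply_C_mul,
    hE.apply_freeCentered]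
  ring

lemma apply_freeTrace_ι_mul_freeWick {N : ℕ} {E : EntryPoly V N →ₗ[ℂ] ℂ}
    (hE : IsGaussianFunctional E) (f : V) (u : List V) :
    E (freeTrace N (FreeAlgebra.ι ℂ f * freeWick u)) =
      splitSum (fun a g b => (1 / N : ℂ) * (inner ℝ f g : ℝ) *
        E (freeTrace N (freeWick a) * freeTrace N (freeWick b))) u := by
  have h := hE.trace_mul f (hasWordDeriv_wickIn u) (G := 1) (Γ := 0) (fun i j => by simp)
  simpa only [mul_one, Matrix.mul_zero, Matrix.trace_zero, map_zero, add_zero,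
    ← freeTrace_ι_mul_freeWick, ← freeTrace_freeWick] using h

/-- The indicator of the empty word. -/
def emptyInd : List V → ℂ
  | [] => 1
  | _ :: _ => 0

/-- Integrating the first letter by parts splits the rest into two Wick words, and by induction only
two empty parts contribute in the limit. The recursion for Wick words subtracts exactly that
contribution. -/
lemma tendsto_freeTrace_freeWick (hE : ∀ N, IsGaussianFunctional (E N)) (u : List V) :
    Tendsto (fun N : ℕ => 1 / (N : ℂ) * E N (freeTrace N (freeWick u))) atTop (𝓝 (emptyInd u)) := by
  -- Asymptotic factorization: the covariance of the two traces is bounded and disappears under the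
  -- factor `1 / N ^ 2`.
  have hpair : ∀ a b : List V,
      Tendsto (fun N : ℕ => 1 / (N : ℂ) * E N (freeTrace N (freeWick a))) atTop (𝓝 (emptyInd a)) →
      Tendsto (fun N : ℕ => 1 / (N : ℂ) * E N (freeTrace N (freeWick b))) atTop (𝓝 (emptyInd b)) →
      Tendsto (fun N : ℕ => (1 / (N : ℂ) * (1 / (N : ℂ))) *
        E N (freeTrace N (freeWick a) * freeTrace N (freeWick b))) atTop
        (𝓝 (emptyInd a * emptyInd b)) := by
    intro a b ha hb
    have h0 : Tendsto (fun N : ℕ => 1 / (N : ℂ) * (1 / (N : ℂ))) atTop (𝓝 0) := by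
      simpa using tendsto_inv_nat.mul tendsto_inv_nat
    have h1 := IsBdd.tendsto_mul h0 (isBdd_freeCentered_two hE (freeWick a) (freeWick b))
    have h2 := h1.add (ha.mul hb)
    rw [zero_add] at h2
    refine h2.congr fun N => ?_
    rw [apply_freeTrace_mul_freeTrace (hE N)]
    ring
  induction hn : u.length using Nat.strong_induction_on generalizing u with
  | _ n ih =>
    have hstep : ∀ (f : V) (v : List V), v.length < n →
        Tendsto (fun N : ℕ => 1 / (N : ℂ) * E N (freeTrace N (FreeAlgebra.ι ℂ f * freeWick v))) atTop
          (𝓝 (splitSum (fun a g b => (inner ℝ f g : ℝ) * (emptyInd a * emptyInd b)) v)) := by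
      intro f v hv
      simp only [apply_freeTrace_ι_mul_freeWick (hE _), mul_splitSum]
      refine tendsto_splitSum fun a g b e => ?_
      have hl : a.length + b.length + 1 = v.length := by rw [← e]; simp; omega
      refine ((hpair a b (ih _ (by omega) a rfl) (ih _ (by omega) b rfl)).const_mul
        ((inner ℝ f g : ℝ) : ℂ)).congr fun N => ?_
      ring
    match u with
    | [] =>
      refine (tendsto_const_nhds (x := (1 : ℂ))).congr' ?_
      filter_upwards [eventually_ne_atTop 0] with N hN
      have h1 : freeTrace N (freeWick ([] : List V)) = wordTrace N ([] : List V) := by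
        rw [← freeTrace_freeWord]; rfl
      rw [h1, (hE N).apply_wordTrace_nil]
      field_simp
    | [f] =>
      have h := hstep f [] (by simp [← hn])
      simpa [emptyInd] using h
    | f :: g :: l =>
      have h1 := hstep f (g :: l) (by simp [← hn])
      have h2 := (ih l.length (by simp [← hn]) l rfl).const_mul ((inner ℝ f g : ℝ) : ℂ)
      have h3 := h1.sub h2
      have h4 : splitSum (fun a g b => (inner ℝ f g : ℝ) * (emptyInd a * emptyInd b)) (g :: l) -
          (inner ℝ f g : ℝ) * emptyInd l = emptyInd (f :: g :: l) := by
        rw [splitSum_cons]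
        simp only [emptyInd, zero_mul, mul_zero, splitSum_zero, one_mul, add_zero, sub_self]
      rw [h4] at h3
      refine h3.congr fun N => ?_
      have e : freeWick (f :: g :: l) = FreeAlgebra.ι ℂ f * freeWick (g :: l) -
          ((inner ℝ f g : ℝ) : ℂ) • freeWick l := wickIn_cons_cons _ _ _ _
      rw [e, map_sub, map_sub, map_smul, map_smul, smul_eq_mul]
      ring

/-- The product rule peels off the letters at the junction. Each uncontracted nonempty Wick word has
vanishing limit, so only the full contraction of `u` with the reversal of `v` survives. -/
lemma tendsto_freeTrace_freeWick_mul (hE : ∀ N, IsGaussianFunctional (E N)) (u v : List V) :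
    Tendsto (fun N : ℕ => 1 / (N : ℂ) * E N (freeTrace N (freeWick u * freeWick v))) atTop
      (𝓝 (listInner (u.map Cplx.ofReal) (v.reverse.map Cplx.ofReal))) := by
  induction v generalizing u with
  | nil =>
    have h := tendsto_freeTrace_freeWick hE u
    have e : listInner (u.map Cplx.ofReal) (([] : List V).reverse.map Cplx.ofReal) =
        emptyInd u := by cases u <;> simp [listInner, emptyInd]
    simpa only [e, freeWick, wickIn_nil, mul_one] using h
  | cons y v ih =>
    rcases List.eq_nil_or_concat u with rfl | ⟨u, x, rfl⟩
    · have h := tendsto_freeTrace_freeWick hE (y :: v)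
      rw [listInner_of_length_ne (by simp)]
      simpa only [freeWick, wickIn_nil, one_mul, emptyInd] using h
    · have h1 := tendsto_freeTrace_freeWick hE (u ++ x :: y :: v)
      have h2 := (ih u).const_mul ((inner ℝ x y : ℝ) : ℂ)
      have h3 := h1.add h2
      have e0 : emptyInd (u ++ x :: y :: v) = 0 := by cases u <;> rfl
      have e : listInner ((u.concat x).map Cplx.ofReal) ((y :: v).reverse.map Cplx.ofReal) =
          emptyInd (u ++ x :: y :: v) + (inner ℝ x y : ℝ) *
            listInner (u.map Cplx.ofReal) (v.reverse.map Cplx.ofReal) := by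
        rw [e0, zero_add]
        simp only [List.concat_eq_append, List.map_append, List.map_cons, List.map_nil,
          List.reverse_cons]
        by_cases hl : u.length = v.length
        · rw [listInner_concat (by simpa using hl), form_ofReal, mul_comm]
        · rw [listInner_of_length_ne (by simpa using hl),
            listInner_of_length_ne (by simpa using hl), mul_zero]
      rw [e]
      refine h3.congr fun N => ?_
      rw [List.concat_eq_append, wickIn_concat_mul_wickIn_cons, map_add, map_add, map_smul,
        map_smul, smul_eq_mul]
      ring

/-! ### The limit covariance of cyclic Wick words -/

/-- The cyclic Wick words in the free algebra. -/
noncomputable abbrev freeCyclic (u : List V) : FreeAlgebra ℂ V := cyclicIn (FreeAlgebra.ι ℂ) u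

/-- The cyclic derivative of a cyclic Wick word in the direction `f`. -/
noncomputable def cyclicDeriv (f : V) (w : List V) : FreeAlgebra ℂ V :=
  splitSum (fun a g b => ((inner ℝ f g : ℝ) : ℂ) • freeWick (b ++ a)) w

/-- Only contractions of `f` with the first and the last letter of `u` contribute, and a sole letter
counts twice. The sum runs over all splittings in order to match the Schwinger–Dyson equation term
by term, `emptyInd` being the limit of the normalized trace. -/
lemma freeCyclic_cons (f : V) (u : List V) :
    freeCyclic (f :: u) = FreeAlgebra.ι ℂ f * freeWick u -
      splitSum (fun a g b => ((inner ℝ f g : ℝ) : ℂ) •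
        (emptyInd a • freeWick b + emptyInd b • freeWick a)) u := by
  have h1 : splitSum (fun a g b => ((inner ℝ f g : ℝ) : ℂ) •
        (emptyInd a • freeWick b + emptyInd b • freeWick a)) u =
      splitSum (fun a g b => ((inner ℝ f g : ℝ) : ℂ) • (emptyInd a • freeWick b)) u +
      splitSum (fun a g b => ((inner ℝ f g : ℝ) : ℂ) • (emptyInd b • freeWick a)) u := by
    simp only [smul_add, splitSum_add]
  have h2 : ∀ (g : V) (l : List V),
      splitSum (fun a g b => ((inner ℝ f g : ℝ) : ℂ) • (emptyInd a • freeWick b)) (g :: l) =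
        ((inner ℝ f g : ℝ) : ℂ) • freeWick l := by
    intro g l
    rw [splitSum_cons]
    simp only [emptyInd, zero_smul, one_smul, smul_zero, splitSum_zero, add_zero]
  have h3 : ∀ (h : V) (l : List V),
      splitSum (fun a g b => ((inner ℝ f g : ℝ) : ℂ) • (emptyInd b • freeWick a)) (l ++ [h]) =
        ((inner ℝ f h : ℝ) : ℂ) • freeWick l := by
    intro h l
    rw [splitSum_concat]
    have : ∀ b : List V, emptyInd (b ++ [h]) = 0 := by intro b; cases b <;> rfl
    simp only [this, zero_smul, smul_zero, splitSum_zero, zero_add]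
    simp only [emptyInd, one_smul]
  rw [h1]
  rcases List.eq_nil_or_concat u with rfl | ⟨l, h, e⟩
  · simp [freeCyclic, cyclicIn]
  · rw [List.concat_eq_append] at e
    cases u with
    | nil => simp at e
    | cons g m =>
      rw [h2, e, h3, freeCyclic, cyclicIn_cons_concat, ← e, wickIn_cons_cons]
      abel

lemma freeCyclic_cons_concat (f h : V) (l : List V) :
    freeCyclic (f :: (l ++ [h])) = freeWick (f :: (l ++ [h])) -
      ((inner ℝ f h : ℝ) : ℂ) • freeWick l := cyclicIn_cons_concat _ _ _ _

lemma entryDeriv_freeTrace_freeWick {N : ℕ} (f : V) (i j : Fin N) (w : List V) :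
    entryDeriv f i j (freeTrace N (freeWick w)) =
      ((1 / N : ℂ) • splitSum (fun a g b => ((inner ℝ f g : ℝ) : ℂ) •
        (LinearMap.id (R := ℂ)) (wickIn (genMat N) b * wickIn (genMat N) a)) w :
          Matrix (Fin N) (Fin N) (EntryPoly V N)) i j := by
  rw [freeTrace_freeWick, (hasWordDeriv_wickIn w).entryDeriv_trace, smul_splitSum]
  simp only [smul_smul, LinearMap.id_apply]

/-- Differentiating a trace of a Wick word produces products of two Wick words; for cyclic words
`cyclic_derivative_cyclicIn` collapses them to single ones. -/
lemma entryDeriv_freeTrace_freeCyclic {N : ℕ} (f : V) (i j : Fin N) {w : List V} (hw : w ≠ []) :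
    entryDeriv f i j (freeTrace N (freeCyclic w)) =
      ((1 / N : ℂ) • FreeAlgebra.lift ℂ (genMat N) (cyclicDeriv f w) :
        Matrix (Fin N) (Fin N) (EntryPoly V N)) i j := by
  have h0 : FreeAlgebra.lift ℂ (genMat N) (cyclicDeriv f w) =
      splitSum (fun a g b => ((inner ℝ f g : ℝ) : ℂ) •
        (LinearMap.id (R := ℂ)) (wickIn (genMat N) (b ++ a))) w := by
    rw [cyclicDeriv, map_splitSum]
    simp only [map_smul, lift_freeWick, LinearMap.id_apply]
  rw [h0]
  match w, hw with
  | [g], _ =>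
    have := entryDeriv_freeTrace_freeWick f i j [g]
    simpa [freeCyclic, cyclicIn, splitSum_cons] using this
  | h₁ :: g :: l, _ =>
    obtain ⟨m, h₂, e⟩ : ∃ m h, g :: l = m ++ [h] :=
      ⟨(g :: l).dropLast, (g :: l).getLast (by simp), (List.dropLast_append_getLast _).symm⟩
    rw [e, freeCyclic_cons_concat, map_sub, map_smul, map_sub, Derivation.map_smul,
      entryDeriv_freeTrace_freeWick, entryDeriv_freeTrace_freeWick, ← cyclic_derivative_cyclicIn,
      smul_sub, Matrix.sub_apply, smul_comm (1 / N : ℂ)]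
    rfl

/-- The Schwinger–Dyson equation with the second trace as the factor `G`, after subtracting the
product of the expectations. -/
lemma covariance_ι_mul_freeWick {N : ℕ} {E : EntryPoly V N →ₗ[ℂ] ℂ}
    (hE : IsGaussianFunctional E) (f : V) (u : List V) {w : List V} (hw : w ≠ []) :
    E (freeCentered E (FreeAlgebra.ι ℂ f * freeWick u) * freeCentered E (freeCyclic w)) =
      splitSum (fun a g b => (1 / N : ℂ) * (inner ℝ f g : ℝ) *
        (E (freeCentered E (freeWick a) * freeCentered E (freeWick b) *
            freeCentered E (freeCyclic w)) +
          E (freeTrace N (freeWick a)) *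
            E (freeCentered E (freeWick b) * freeCentered E (freeCyclic w)) +
          E (freeTrace N (freeWick b)) *
            E (freeCentered E (freeWick a) * freeCentered E (freeCyclic w)))) u +
      1 / N * E (freeTrace N (freeWick u * cyclicDeriv f w)) := by
  have h := hE.trace_mul f (hasWordDeriv_wickIn u)
    (fun i j => entryDeriv_freeTrace_freeCyclic f i j hw)
  have h1 := apply_freeTrace_mul_freeTrace hE (FreeAlgebra.ι ℂ f * freeWick u) (freeCyclic w)
  rw [eq_comm, ← eq_sub_iff_add_eq, freeTrace_ι_mul_freeWick, h, ← freeTrace_ι_mul_freeWick,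
    apply_freeTrace_ι_mul_freeWick hE, splitSum_mul, add_sub_right_comm, ← splitSum_sub] at h1
  rw [h1]
  congr 1
  · refine splitSum_congr fun a g b _ => ?_
    rw [← apply_freeTrace_mul_mul_sub hE, freeTrace_freeWick, freeTrace_freeWick]
    ring
  · rw [mul_smul_comm, Matrix.trace_smul, map_smul, smul_eq_mul, freeTrace_apply, map_mul,
      lift_freeWick]

/-- The limit covariance of traces of cyclic Wick words. -/
lemma tendsto_covariance_freeCyclic (hE : ∀ N, IsGaussianFunctional (E N)) (f : V) (u : List V)
    {w : List V} (hw : w ≠ []) :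
    Tendsto (fun N => E N (freeCentered (E N) (freeCyclic (f :: u)) *
        freeCentered (E N) (freeCyclic w))) atTop
      (𝓝 (splitSum (fun a g b => (inner ℝ f g : ℝ) *
        listInner (u.map Cplx.ofReal) ((b ++ a).reverse.map Cplx.ofReal)) w)) := by
  have hmain : Tendsto (fun N : ℕ => 1 / (N : ℂ) * E N (freeTrace N (freeWick u * cyclicDeriv f w)))
      atTop (𝓝 (splitSum (fun a g b => (inner ℝ f g : ℝ) *
        listInner (u.map Cplx.ofReal) ((b ++ a).reverse.map Cplx.ofReal)) w)) := by
    simp only [cyclicDeriv, mul_splitSum, map_splitSum]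
    refine tendsto_splitSum fun a g b _ => ?_
    refine ((tendsto_freeTrace_freeWick_mul hE u (b ++ a)).const_mul
      ((inner ℝ f g : ℝ) : ℂ)).congr fun N => ?_
    rw [mul_smul_comm, map_smul, map_smul, smul_eq_mul]
    ring
  -- The split-trace terms minus the contractions contained in the cyclic word: every summand is a
  -- null sequence times a bounded one.
  have herr : Tendsto (fun N : ℕ => splitSum (fun a g b => (inner ℝ f g : ℝ) *
      (1 / (N : ℂ) * E N (freeCentered (E N) (freeWick a) * freeCentered (E N) (freeWick b) *
            freeCentered (E N) (freeCyclic w)) +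
        (1 / (N : ℂ) * E N (freeTrace N (freeWick a)) - emptyInd a) *
          E N (freeCentered (E N) (freeWick b) * freeCentered (E N) (freeCyclic w)) +
        (1 / (N : ℂ) * E N (freeTrace N (freeWick b)) - emptyInd b) *
          E N (freeCentered (E N) (freeWick a) * freeCentered (E N) (freeCyclic w)))) u)
      atTop (𝓝 0) := by
    have h0 : (0 : ℂ) = splitSum (fun _ _ _ => 0) u := (splitSum_zero u).symm
    rw [h0]
    refine tendsto_splitSum fun a g b _ => ?_
    have hd : ∀ a : List V, Tendsto (fun N : ℕ =>
        1 / (N : ℂ) * E N (freeTrace N (freeWick a)) - emptyInd a) atTop (𝓝 0) := by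
      intro a
      simpa using (tendsto_freeTrace_freeWick hE a).sub_const (emptyInd a)
    have h1 := IsBdd.tendsto_mul tendsto_inv_nat
      (isBdd_freeCentered_three hE (freeWick a) (freeWick b) (freeCyclic w))
    have h2 := IsBdd.tendsto_mul (hd a) (isBdd_freeCentered_two hE (freeWick b) (freeCyclic w))
    have h3 := IsBdd.tendsto_mul (hd b) (isBdd_freeCentered_two hE (freeWick a) (freeCyclic w))
    simpa using ((h1.add h2).add h3).const_mul ((inner ℝ f g : ℝ) : ℂ)
  have := herr.add hmain
  rw [zero_add] at this
  refine this.congr fun N => ?_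
  have e : E N (freeCentered (E N) (splitSum (fun a g b => ((inner ℝ f g : ℝ) : ℂ) •
        (emptyInd a • freeWick b + emptyInd b • freeWick a)) u) *
          freeCentered (E N) (freeCyclic w)) =
      splitSum (fun a g b => ((inner ℝ f g : ℝ) : ℂ) *
        (emptyInd a * E N (freeCentered (E N) (freeWick b) * freeCentered (E N) (freeCyclic w)) +
          emptyInd b * E N (freeCentered (E N) (freeWick a) *
            freeCentered (E N) (freeCyclic w)))) u := by
    rw [map_splitSum, splitSum_mul, map_splitSum]
    refine splitSum_congr fun a g b _ => ?_
    simp only [map_smul, map_add, smul_mul_assoc, add_mul, smul_eq_mul]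
  rw [freeCyclic_cons, map_sub, sub_mul, map_sub, e, covariance_ι_mul_freeWick (hE N) f u hw,
    add_sub_right_comm, ← splitSum_sub]
  congr 1
  refine splitSum_congr fun a g b _ => ?_
  ring

/-- A rotation of the reversed word is determined by the letter `g` that meets `f`; reversal
exchanges the parts before and after `g`. -/
lemma cycInner_eq_splitSum (f : V) (u : List V) {w : List V} (hw : w ≠ []) :
    cycInner (circWord ((f :: u).map Cplx.ofReal)) (circWord (w.reverse.map Cplx.ofReal)) =
      splitSum (fun a g b => (inner ℝ f g : ℝ) *
        listInner (u.map Cplx.ofReal) ((b ++ a).reverse.map Cplx.ofReal)) w := by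
  rw [cycInner_circWord _ (by simpa using hw), List.length_map]
  simp only [← List.map_rotate]
  rw [← splitSum_eq_sum_rotate (fun v : List V =>
    listInner ((f :: u).map Cplx.ofReal) (v.map Cplx.ofReal)), splitSum_reverse]
  refine splitSum_congr fun a g b _ => ?_
  simp only [List.map_cons, listInner, form_ofReal, List.reverse_append]

end Asymptotics

/-! ### Traces of Gaussian random matrices -/

section RandomMatrix

variable {V : Type*} [NormedAddCommGroup V] [InnerProductSpace ℝ V]

section Fixed

variable {N : ℕ} {Ω : Type*} [MeasurableSpace Ω] {P : Measure Ω} [IsProbabilityMeasure P]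
  {X : V → Ω → Matrix (Fin N) (Fin N) ℂ}

/-- The entries of a family of random matrices. -/
def entries (X : V → Ω → Matrix (Fin N) (Fin N) ℂ) (t : V × Fin N × Fin N) (a : Ω) : ℂ :=
  X t.1 a t.2.1 t.2.2

lemma IsHermitianGaussianFamily.hasMoments (hX : IsHermitianGaussianFamily P X)
    (t : V × Fin N × Fin N) : HasMoments P (entries X t) :=
  fun _ hp => (hX.gaussian.hasGaussianLaw_eval t).memLp hp

lemma IsHermitianGaussianFamily.conj_apply (hX : IsHermitianGaussianFamily P X) (f : V)
    (i j : Fin N) : ∀ᵐ a ∂P, conj (X f a i j) = X f a j i := by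
  filter_upwards [hX.hermitian f] with a ha
  exact ha.apply j i

/-- The covariances of all entries. -/
lemma IsHermitianGaussianFamily.integral_mul (hX : IsHermitianGaussianFamily P X) (f g : V)
    (i j k l : Fin N) :
    ∫ a, X f a i j * X g a k l ∂P =
      if (k, l) = (j, i) then (1 / N : ℂ) * (inner ℝ f g : ℝ) else 0 := by
  have hconj : ∀ F : Ω → ℂ, ∫ a, F a ∂P = conj (∫ a, conj (F a) ∂P) := by
    intro F
    rw [← integral_conj]
    simp
  -- The assumed covariances concern the upper triangle only. Hermitian symmetry turns a lower entry
  -- into a conjugated upper one, and `hflip` transposes both entries at the price of a conjugation.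
  have hle : ∀ i j k l : Fin N, i ≤ j → l ≤ k → ∫ a, X f a i j * X g a k l ∂P =
      if (k, l) = (j, i) then (1 / N : ℂ) * (inner ℝ f g : ℝ) else 0 := by
    intro i j k l hij hlk
    have h1 : ∫ a, X f a i j * X g a k l ∂P = ∫ a, X f a i j * conj (X g a l k) ∂P := by
      refine integral_congr_ae ?_
      filter_upwards [hX.conj_apply g l k] with a ha
      rw [ha]
    rw [h1, hX.cov_conj f g i j l k hij hlk]
    by_cases h : k = j ∧ l = i
    · rw [if_pos ⟨h.2.symm, h.1.symm⟩, if_pos (by rw [h.1, h.2])]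
      ring
    · rw [if_neg (fun h' => h ⟨h'.2.symm, h'.1.symm⟩), if_neg (by simpa using h)]
  have hflip : ∫ a, X f a i j * X g a k l ∂P = conj (∫ a, X f a j i * X g a l k ∂P) := by
    rw [hconj]
    congr 1
    refine integral_congr_ae ?_
    filter_upwards [hX.conj_apply f i j, hX.conj_apply g k l] with a h1 h2
    rw [map_mul, h1, h2]
  rcases le_or_gt i j with hij | hij
  · rcases le_or_gt l k with hlk | hlk
    · exact hle i j k l hij hlk
    · rcases hij.lt_or_eq with hij' | rfl
      · rw [hX.cov_self f g i j k l hij' hlk, if_neg]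
        rintro h
        simp only [Prod.mk.injEq] at h
        rw [h.1, h.2] at hlk
        exact absurd hlk hij'.not_gt
      · rw [hflip, hle i i l k le_rfl hlk.le, if_neg, if_neg, map_zero]
        · simp only [Prod.mk.injEq]
          rintro ⟨rfl, rfl⟩
          exact lt_irrefl _ hlk
        · simp only [Prod.mk.injEq]
          rintro ⟨rfl, rfl⟩
          exact lt_irrefl _ hlk
  · rcases le_or_gt k l with hkl | hkl
    · rw [hflip, hle j i l k hij.le hkl]
      have h3 : ((l, k) = (i, j)) ↔ ((k, l) = (j, i)) := by
        simp only [Prod.mk.injEq]; exact and_comm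
      simp only [h3]
      split_ifs <;> simp
    · rw [hflip, hX.cov_self f g j i l k hij hkl, if_neg, map_zero]
      rintro h
      simp only [Prod.mk.injEq] at h
      rw [h.1, h.2] at hkl
      exact absurd hkl hij.not_gt

lemma IsHermitianGaussianFamily.isGaussianFunctional (hX : IsHermitianGaussianFamily P X) :
    IsGaussianFunctional (polyExp (entries X) hX.hasMoments) where
  one := by simp [polyExp_apply]
  ibp f i j p := by
    have h : (fun t => ∫ a, entries X (f, i, j) a * entries X t a ∂P) =
        fun s => if s.2 = (j, i) then (1 / N : ℂ) * (inner ℝ f s.1 : ℝ) else 0 :=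
      funext fun t => hX.integral_mul f t.1 i j t.2.1 t.2.2
    have h1 := polyExp_X_mul (Z := entries X) hX.gaussian (fun t => hX.centered _ _ _)
      hX.hasMoments (f, i, j) p
    rw [h] at h1
    exact h1

/-- Evaluation of the indeterminates is an algebra homomorphism, so it commutes with forming
noncommutative polynomials and traces. -/
lemma aeval_freeTrace (X : V → Ω → Matrix (Fin N) (Fin N) ℂ) (a : Ω) (x : FreeAlgebra ℂ V) :
    MvPolynomial.aeval (fun t => entries X t a) (freeTrace N x) =
      (FreeAlgebra.lift ℂ (fun f => X f a) x).trace := by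
  have h : ((MvPolynomial.aeval fun t => entries X t a :
      EntryPoly V N →ₐ[ℂ] ℂ).mapMatrix).comp (FreeAlgebra.lift ℂ (genMat N)) =
      FreeAlgebra.lift ℂ (fun f => X f a) := by
    apply FreeAlgebra.hom_ext
    funext f
    ext i j
    simp [genMat, entries]
  rw [← h, freeTrace_apply, AlgHom.comp_apply, AlgHom.mapMatrix_apply]
  exact AddMonoidHom.map_trace (MvPolynomial.aeval fun t => entries X t a : EntryPoly V N →ₐ[ℂ] ℂ) _

lemma aeval_polyV {B : Type*} [Ring B] [Algebra ℂ B] (ξ : V → B) {f : V} (hf : ‖f‖ = 1) (n : ℕ) :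
    Polynomial.aeval (ξ f) (polyV n) = wickIn ξ (List.replicate n f) := by
  rw [wickIn_replicate ξ hf, polyV, Polynomial.aeval_comp]
  congr 2
  simp [Algebra.smul_def]

lemma aeval_polyT {B : Type*} [Ring B] [Algebra ℂ B] (ξ : V → B) {f : V} (hf : ‖f‖ = 1) {n : ℕ}
    (hn : 1 ≤ n) : Polynomial.aeval (ξ f) (polyT n) = cyclicIn ξ (List.replicate n f) := by
  rw [cyclicIn_replicate ξ hf hn, polyT, map_mul, Polynomial.aeval_comp, map_ofNat,
    ← map_ofNat (algebraMap ℂ B) 2, ← Algebra.smul_def]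
  congr 3
  simp [Algebra.smul_def]

/-- Orthogonality of neighbours merges the Chebyshev factors into one Wick word, and orthogonality
of last and first letter makes this the cyclic word. A single unit vector is not orthogonal to
itself, whence `polyT` in that case. -/
lemma traceV_eq (X : V → Ω → Matrix (Fin N) (Fin N) ℂ) {k : ℕ} {f : Fin k → V} {n : Fin k → ℕ}
    (hf : ∀ i, ‖f i‖ = 1) (hn : ∀ i, 0 < n i) (h : CyclicallyOrthogonal f) (a : Ω) :
    traceV X f n a =
      MvPolynomial.aeval (fun t => entries X t a) (freeTrace N (freeCyclic (realBlocks f n))) := by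
  rw [aeval_freeTrace, freeCyclic, map_cyclicIn, cyclicIn_realBlocks _ f n hn h,
    wickIn_realBlocks _ f n hn h.inner_succ, traceV]
  congr 3
  funext i
  have := aeval_polyV (fun f => X f a) (hf i) (n i)
  rw [this]
  congr 1
  funext f
  simp

lemma traceT_eq (X : V → Ω → Matrix (Fin N) (Fin N) ℂ) {f : V} {n : ℕ} (hf : ‖f‖ = 1)
    (hn : 0 < n) (a : Ω) :
    traceT X f n a = MvPolynomial.aeval (fun t => entries X t a)
      (freeTrace N (freeCyclic (List.replicate n f))) := by
  rw [aeval_freeTrace, freeCyclic, map_cyclicIn, traceT]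
  have := aeval_polyT (fun f => X f a) hf hn
  rw [this]
  congr 2
  funext f
  simp

end Fixed

/-- The limit covariance of the traces of cyclic Wick words in Gaussian random matrices. -/
lemma hasLimitCovariance_freeCyclic {Ω : ℕ → Type*} [∀ N, MeasurableSpace (Ω N)]
    (P : ∀ N, Measure (Ω N)) [∀ N, IsProbabilityMeasure (P N)]
    (X : ∀ N, V → Ω N → Matrix (Fin N) (Fin N) ℂ)
    (hX : ∀ N, IsHermitianGaussianFamily (P N) (X N)) {v w : List V} (hv : v ≠ []) (hw : w ≠ [])
    {A B : ∀ N, Ω N → ℂ}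
    (hA : ∀ N a, A N a = MvPolynomial.aeval (fun t => entries (X N) t a)
      (freeTrace N (freeCyclic v)))
    (hB : ∀ N a, B N a = MvPolynomial.aeval (fun t => entries (X N) t a)
      (freeTrace N (freeCyclic w))) :
    HasLimitCovariance P A B
      (cycInner (circWord (v.map Cplx.ofReal)) (circWord (w.reverse.map Cplx.ofReal))) := by
  have hA' : ∀ N, A N = _ := fun N => funext (hA N)
  have hB' : ∀ N, B N = _ := fun N => funext (hB N)
  refine ⟨fun N => ⟨?_, ?_⟩, ?_⟩
  · rw [hA' N]
    exact hasMoments_aeval (hX N).hasMoments _ 2 (by simp)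
  · rw [hB' N]
    exact hasMoments_aeval (hX N).hasMoments _ 2 (by simp)
  · obtain ⟨f, u, rfl⟩ := List.exists_cons_of_ne_nil hv
    rw [cycInner_eq_splitSum f u hw]
    have hE := fun N => (hX N).isGaussianFunctional
    refine (tendsto_covariance_freeCyclic hE f u hw).congr fun N => ?_
    have h := apply_freeTrace_mul_freeTrace (hE N) (freeCyclic (f :: u)) (freeCyclic w)
    rw [← sub_eq_iff_eq_add] at h
    rw [← h, cumulant₂]
    simp only [polyExp_apply, map_mul, hA, hB]

end RandomMatrix

end CyclicFock

/-! ### Assembly of the statements. -/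

theorem mainTheorem10 {V : Type*} [NormedAddCommGroup V] [InnerProductSpace ℝ V] :
    -- The Wick products are the unique elements of the algebra with `W(f₁ ⊗ ⋯ ⊗ fₙ) Ω = f₁ ⊗ ⋯ ⊗ fₙ`.
    (∀ l : List (Cplx V), wick l ∈ fieldAlgebra V ∧ wick l 1 = word l ∧
      ∀ w ∈ fieldAlgebra V, w 1 = word l → w = wick l) ∧
    -- The cyclic Wick products satisfy `𝐜 C(f₁ ⊗ ⋯ ⊗ fₙ) Ω = [f₁ ⊗ ⋯ ⊗ fₙ]`.
    (∀ l : List (Cplx V), l ≠ [] →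
      cyclicWick l ∈ fieldAlgebra V ∧ cyclize (cyclicWick l 1) = circWord l) ∧
    -- The one-dimensional case: Chebyshev polynomials.
    (∀ f : V, ‖f‖ = 1 →
      (∀ n : ℕ, wick (power f n) =
        Polynomial.aeval ((1 / 2 : ℂ) • field (Cplx.ofReal f)) (Polynomial.Chebyshev.U ℂ n)) ∧
      (∀ n : ℕ, 1 ≤ n → cyclicWick (power f n) =
        (2 : ℂ) • Polynomial.aeval ((1 / 2 : ℂ) • field (Cplx.ofReal f))
          (Polynomial.Chebyshev.T ℂ n))) ∧
    -- The multi-dimensional case: products over successive orthogonal blocks.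
    (∀ (k : ℕ) (f : Fin k → V) (n : Fin k → ℕ), (∀ i, 0 < n i) →
      (∀ i j : Fin k, (i : ℕ) + 1 = j → inner ℝ (f i) (f j) = 0) →
      wick (blocks f n) = (List.ofFn fun i => wick (power (f i) (n i))).prod) ∧
    (∀ (k : ℕ) (f : Fin k → V) (n : Fin k → ℕ), 1 ≤ k → (∀ i, 0 < n i) →
      CyclicallyOrthogonal f →
      cyclicWick (blocks f n) = wick (blocks f n) ∧
      cyclicWick (blocks f n) = (List.ofFn fun i => wick (power (f i) (n i))).prod) ∧
    -- The limit covariances of the corresponding traces of random matrices.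
    (∀ (Ω : ℕ → Type*) [∀ N, MeasurableSpace (Ω N)] (P : ∀ N, Measure (Ω N))
      [∀ N, IsProbabilityMeasure (P N)] (X : ∀ N, V → Ω N → Matrix (Fin N) (Fin N) ℂ),
      (∀ N, IsHermitianGaussianFamily (P N) (X N)) →
      (∀ (k l : ℕ) (f : Fin k → V) (n : Fin k → ℕ) (g : Fin l → V) (m : Fin l → ℕ),
        2 ≤ k → 2 ≤ l → (∀ i, ‖f i‖ = 1) → (∀ j, ‖g j‖ = 1) →
        (∀ i, 0 < n i) → (∀ j, 0 < m j) →
        CyclicallyOrthogonal f → CyclicallyOrthogonal g →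
        HasLimitCovariance P (fun N => traceV (X N) f n) (fun N => traceV (X N) g m)
          (cycInner (circWord (blocks f n))
            (circWord (blocks (fun j => g j.rev) (fun j => m j.rev))))) ∧
      (∀ (k : ℕ) (f : Fin k → V) (n : Fin k → ℕ) (g : V) (m : ℕ),
        2 ≤ k → (∀ i, ‖f i‖ = 1) → ‖g‖ = 1 → (∀ i, 0 < n i) → 0 < m →
        CyclicallyOrthogonal f →
        HasLimitCovariance P (fun N => traceV (X N) f n) (fun N => traceT (X N) g m)
          (cycInner (circWord (blocks f n)) (circWord (power g m)))) ∧
      (∀ (f g : V) (n m : ℕ), ‖f‖ = 1 → ‖g‖ = 1 → 0 < n → 0 < m →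
        HasLimitCovariance P (fun N => traceT (X N) f n) (fun N => traceT (X N) g m)
          (cycInner (circWord (power f n)) (circWord (power g m))))) ∧
    -- Diagonalization: for an orthonormal family the elementary circular tensors are orthogonal.
    (∀ (ι : Type*) (e : ι → V), Orthonormal ℝ e → ∀ u v : List ι, v ≠ [] →
      cycInner (circWord (u.map fun i => Cplx.ofReal (e i)))
          (circWord (v.map fun i => Cplx.ofReal (e i))) =
        (Nat.card {k : Fin v.length // v.rotate k = u} : ℂ)) := by
  refine ⟨fun l => ⟨wick_mem_fieldAlgebra l, wick_apply_one l, fun w hw h => wick_unique hw h⟩,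
    fun l hl => ⟨cyclicWick_mem_fieldAlgebra l, cyclize_cyclicWick hl⟩,
    fun f hf => ⟨fun n => ?_, fun n hn => ?_⟩, fun k f n hn h => ?_, fun k f n _ hn h => ?_,
    fun Ω _ P _ X hX => ⟨?_, ?_, ?_⟩, fun ι e he u v hv => cycInner_orthonormal he u v hv⟩
  · rw [power_eq_map, wick_map_ofReal]
    exact wickIn_replicate (fun f : V => field (Cplx.ofReal f)) hf n
  · rw [power_eq_map, cyclicWick_map_ofReal]
    exact cyclicIn_replicate (fun f : V => field (Cplx.ofReal f)) hf hn
  · simp only [power_eq_map, blocks_eq_map_realBlocks, wick_map_ofReal]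
    exact wickIn_realBlocks _ f n hn h
  · simp only [power_eq_map, blocks_eq_map_realBlocks, wick_map_ofReal, cyclicWick_map_ofReal]
    have h1 := cyclicIn_realBlocks (fun f : V => field (Cplx.ofReal f)) f n hn h
    exact ⟨h1, h1.trans (wickIn_realBlocks _ f n hn h.inner_succ)⟩
  · intro k l f n g m hk hl hf hg hn hm hfo hgo
    have := hasLimitCovariance_freeCyclic P X hX (realBlocks_ne_nil (by omega) hn)
      (realBlocks_ne_nil (by omega) hm) (fun N a => traceV_eq (X N) hf hn hfo a)
      (fun N a => traceV_eq (X N) hg hm hgo a)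
    rwa [reverse_realBlocks, ← blocks_eq_map_realBlocks, ← blocks_eq_map_realBlocks] at this
  · intro k f n g m hk hf hg hn hm hfo
    have := hasLimitCovariance_freeCyclic P X hX (realBlocks_ne_nil (by omega) hn)
      (w := List.replicate m g) (by simpa using hm.ne')
      (fun N a => traceV_eq (X N) hf hn hfo a) (fun N a => traceT_eq (X N) hg hm a)
    -- A power of one vector is its own reversal, so the reversed order leaves no trace here.
    rwa [List.reverse_replicate, ← blocks_eq_map_realBlocks, ← power_eq_map] at this
  · intro f g n m hf hg hn hm
    have := hasLimitCovariance_freeCyclic P X hX (v := List.replicate n f)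
      (by simpa using hn.ne') (w := List.replicate m g) (by simpa using hm.ne')
      (fun N a => traceT_eq (X N) hf hn a) (fun N a => traceT_eq (X N) hg hm a)
    rwa [List.reverse_replicate, ← power_eq_map, ← power_eq_map] at this
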